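/- A measurable quadratic differential $q=q(z)\,dz^2$ on $\mathbb C$ is given by a Lebesgue measurable function $q:\mathbb C\to\mathbb C$; its mass is $\|q\|=\int_{\mathbb C}|q(z)|\,dx\,dy\in[0,\infty]$. For an affine map $M(z)=az+b$ put $M^*q=a^2q(az+b)\,dz^2$, and put $$\cos_*q=\Big(\sum_{z:\ \cos z=w}\frac{q(z)}{\sin^2 z}\Big)dw^2 .$$ A sequence $(q_n)$ is called cos-efficient if $\|q_n\|\neq0$ for all $n$ and $\|\cos_*q_n\|/\|q_n\|\to1$. Let $q$ be a meromorphic quadratic differential on $\mathbb C$ with $0<\|q\|<\infty$. A sequence $(q_n)$ of measurable quadratic differentials on $\mathbb C$ has (thick) limit model $q$ with scalings $M_n(z)=a_nz+b_n$ ($a_n,b_n\in\mathbb C$) if $0<\|q_n\|<\infty$ for every $n$, $\lim_n\|q_n\|$ exists, is finite and non-zero, and $\|M_n^*q_n-q\|\to0$. **Proposition.** Suppose that $(q_n)$ has limit model $q$ with scalings $M_n(z)=a_nz+b_n$ and that $(q_n)$ is cos-efficient. Then: 1. $a_n\to0$. 2. Suppose in addition that the poles of $(q_n)$ do not converge to critical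 points $k\pi$ ($k\in\mathbb Z$) of the cosine, in at least one of the following two senses: (a) for every pole $p\in\mathbb C$ of $q$ there is $\delta>0$ such that $|M_n(p)-k\pi|\ge\delta$ for all $k\in\mathbb Z$ and all large $n$; or (b) all $q_n$ are meromorphic on $\mathbb C$ and there is $\delta>0$ such that, for all large $n$, every pole $w$ of $q_n$ in $\mathbb C$ satisfies $|w-k\pi|\ge\delta$ for all $k\in\mathbb Z$. Then, after discarding finitely many $n$ (for which $\cos_*q_n$ might vanish), $(\cos_*q_n)$ is a sequence of measurable quadratic differentials with limit model $q$ and scalings $\hat M_n(z)=-a_n\sin(b_n)\,z+\cos(b_n)$. -/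

import Mathlib

open Filter Topology MeasureTheory
open scoped ENNReal

/-! A quadratic differential `q(z) dz²` on the complex plane is given by its coefficient function
`q : ℂ → ℂ` in the standard coordinate `z`. It is measurable if the coefficient is
(Lebesgue, that is a.e.-) measurable. -/

namespace QuadDiff

/-- The mass `‖q‖_ℂ = ∫_ℂ |q(z)| dx dy`, a value in `[0, ∞]`. -/
noncomputable def mass (q : ℂ → ℂ) : ℝ≥0∞ := ∫⁻ z, ‖q z‖ₑ

/-- The pull-back `f^* (q(w) dw²) = q(f(z)) f'(z)² dz²`. -/
noncomputable def pull (f : ℂ → ℂ) (q : ℂ → ℂ) (z : ℂ) : ℂ := q (f z) * (deriv f z) ^ 2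

/-- The push-forward `f_* (q(z) dz²) = (∑_{f(z) = w} q(z) / f'(z)²) dw²` under an entire function,
as an unconditional sum over all preimages of `w`. (For integrable `q` the sum converges
absolutely for almost every `w`, and the critical values form a null set.) -/
noncomputable def push (f : ℂ → ℂ) (q : ℂ → ℂ) (w : ℂ) : ℂ :=
  ∑' z : {z : ℂ // f z = w}, q z / (deriv f z) ^ 2

/-- The affine map `M(z) = a z + b`. -/
def affine (a b : ℂ) (z : ℂ) : ℂ := a * z + b

/-- `(q_n)` is cos-efficient: `‖q_n‖ ≠ 0` for all `n` and `‖cos_* q_n‖ / ‖q_n‖ → 1`. -/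
def CosEfficient (q : ℕ → ℂ → ℂ) : Prop :=
  (∀ n, mass (q n) ≠ 0) ∧
    Tendsto (fun n => mass (push Complex.cos (q n)) / mass (q n)) atTop (𝓝 1)

/-- The sequence `(q_n)` of measurable quadratic differentials on `ℂ` has the (thick) limit model
`q₀` with scalings `M_n(z) = a_n z + b_n`. Since `0 < ‖q₀‖`, the last condition makes `a_n ≠ 0`
for large `n`. -/
structure HasThickLimitModel (q : ℕ → ℂ → ℂ) (q₀ : ℂ → ℂ) (a b : ℕ → ℂ) : Prop where
  measurable : ∀ n, AEMeasurable (q n) volume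
  mass_pos : ∀ n, 0 < mass (q n)
  mass_lt_top : ∀ n, mass (q n) < ∞
  mass_lim : ∃ L : ℝ≥0∞, L ≠ 0 ∧ L ≠ ∞ ∧ Tendsto (fun n => mass (q n)) atTop (𝓝 L)
  model_meromorphic : Meromorphic q₀
  model_mass_pos : 0 < mass q₀
  model_mass_lt_top : mass q₀ < ∞
  tendsto : Tendsto (fun n => mass (fun z => pull (affine (a n) (b n)) (q n) z - q₀ z))
    atTop (𝓝 0)

/-- `q` has a pole at `p`. -/
def IsPole (q : ℂ → ℂ) (p : ℂ) : Prop := MeromorphicAt q p ∧ meromorphicOrderAt q p < 0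

/-- `w` has distance at least `δ` from every critical point `kπ` of the cosine. -/
def FarFromCritical (δ : ℝ) (w : ℂ) : Prop := ∀ k : ℤ, δ ≤ ‖w - k * (Real.pi : ℂ)‖

/-- The poles of the sequence `(q_n)` that are seen by its limit model, namely the points `M_n(p)`
for the poles `p` of `q₀`, do not converge to critical points of the cosine. -/
def ModelPolesAvoidCritical (q₀ : ℂ → ℂ) (a b : ℕ → ℂ) : Prop :=
  ∀ p, IsPole q₀ p →
    ∃ δ : ℝ, 0 < δ ∧ ∀ᶠ n in atTop, FarFromCritical δ (affine (a n) (b n) p)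

/-- All `q_n` are meromorphic on `ℂ`, and their poles do not converge to critical points of the
cosine. -/
def PolesAvoidCritical (q : ℕ → ℂ → ℂ) : Prop :=
  (∀ n, Meromorphic (q n)) ∧
    ∃ δ : ℝ, 0 < δ ∧ ∀ᶠ n in atTop, ∀ p, IsPole (q n) p → FarFromCritical δ p

theorem pull_affine (a b : ℂ) (q : ℂ → ℂ) (z : ℂ) :
    pull (affine a b) q z = q (a * z + b) * a ^ 2 := by
  have h : HasDerivAt (affine a b) a z := by
    have h1 := ((hasDerivAt_id z).const_mul a).add_const b
    rw [mul_one] at h1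
    exact h1
  simp [pull, h.deriv, affine]

theorem push_cos (q : ℂ → ℂ) (w : ℂ) :
    push Complex.cos q w = ∑' z : {z : ℂ // Complex.cos z = w}, q z / Complex.sin z ^ 2 := by
  simp [push]

end QuadDiff

namespace QuadDiff

/-! Statement 1. Period invariance gives `2 * ‖cos_* q‖ ≤ ‖q + q(· + 2πk)‖`
(`two_mul_mass_push_cos_le`). If `a_n` does not tend to 0, then along a subsequence integers `k_n`
can be chosen with `2πk_n / a_n → T ≠ 0`, and cos-efficiency yields `2‖q₀‖ ≤ ‖q₀ + q₀(· + T)‖` in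
the limit. Equality in the triangle inequality makes the meromorphic quotient `q₀(z + T) / q₀(z)`
real almost everywhere, hence constant. Translation invariance of the mass gives it modulus 1, so
`|q₀|` is periodic, which integrability forbids (`mass_add_translate_lt`).

Statement 2. An integrable entire function vanishes, so `q₀` has a pole. Since `a_n → 0`, either
hypothesis on poles then keeps `b_n` away from the critical points (`exists_farFromCritical`). In
the given scalings the cosine becomes `rescaledCos`, which tends to the identity because `a_n → 0`
and `cot b_n` stays bounded. Hence push-forwards of a test function converge to that function
(`tendsto_mass_pull_push_cos`). Test functions are dense in L¹ and push-forward does not increase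
mass (`mass_push_cos_le`), so the convergence passes to `q_n`. -/

/-! ### Holomorphic change of variables -/

theorem det_restrictScalars_toSpanSingleton (c : ℂ) :
    ((ContinuousLinearMap.toSpanSingleton ℂ c).restrictScalars ℝ).det = ‖c‖ ^ 2 := by
  simp [ContinuousLinearMap.det, LinearMap.det_restrictScalars,
    Algebra.norm_complex_eq, Complex.normSq_eq_norm_sq]

/-- The real Jacobian of a holomorphic map is `|f'|²`. Injectivity is what frees `g` from any
measurability assumption. -/
theorem lintegral_image_eq_of_hasDerivAt {s : Set ℂ} (hs : MeasurableSet s) {f f' : ℂ → ℂ}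
    (hf : ∀ z ∈ s, HasDerivAt f (f' z) z) (hinj : Set.InjOn f s) (g : ℂ → ℝ≥0∞) :
    ∫⁻ w in f '' s, g w = ∫⁻ z in s, ‖f' z‖ₑ ^ 2 * g (f z) := by
  rw [lintegral_image_eq_lintegral_abs_det_fderiv_mul volume hs
    (fun z hz => ((hf z hz).hasFDerivAt.restrictScalars ℝ).hasFDerivWithinAt) hinj]
  refine lintegral_congr fun z => ?_
  rw [det_restrictScalars_toSpanSingleton, abs_of_nonneg (by positivity),
    ENNReal.ofReal_pow (norm_nonneg _), ofReal_norm]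

theorem measurableSet_image_of_hasDerivAt {s : Set ℂ} (hs : MeasurableSet s) {f f' : ℂ → ℂ}
    (hf : ∀ z ∈ s, HasDerivAt f (f' z) z) (hinj : Set.InjOn f s) : MeasurableSet (f '' s) :=
  measurable_image_of_fderivWithin hs
    (fun z hz => ((hf z hz).hasFDerivAt.restrictScalars ℝ).hasFDerivWithinAt) hinj

theorem volume_image_eq_zero {f : ℂ → ℂ} (hf : Differentiable ℂ f) {s : Set ℂ}
    (hs : volume s = 0) : volume (f '' s) = 0 :=
  addHaar_image_eq_zero_of_differentiableOn_of_addHaar_eq_zero volume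
    (hf.restrictScalars ℝ).differentiableOn hs

/-! ### Affine maps -/

theorem lintegral_comp_affine {a : ℂ} (ha : a ≠ 0) (b : ℂ) (g : ℂ → ℝ≥0∞) :
    ∫⁻ z, ‖a‖ₑ ^ 2 * g (a * z + b) = ∫⁻ w, g w := by
  have h := lintegral_image_eq_of_hasDerivAt (s := Set.univ) MeasurableSet.univ
    (f := fun z => a * z + b) (f' := fun _ => a)
    (fun z _ => by simpa using ((hasDerivAt_id z).const_mul a).add_const b)
    (fun x _ y _ hxy => by simpa [ha] using hxy) g
  have him : (fun z : ℂ => a * z + b) '' Set.univ = Set.univ := by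
    rw [Set.image_univ, Set.range_eq_univ]
    intro w
    exact ⟨(w - b) / a, by field_simp; ring⟩
  rw [him] at h
  simpa using h.symm

theorem mass_pull_affine {a : ℂ} (ha : a ≠ 0) (b : ℂ) (q : ℂ → ℂ) :
    mass (pull (affine a b) q) = mass q := by
  rw [mass, mass, ← lintegral_comp_affine ha b fun z => ‖q z‖ₑ]
  refine lintegral_congr fun z => ?_
  rw [pull_affine, enorm_mul, enorm_pow, mul_comm]

theorem pull_affine_sub (a b : ℂ) (p q : ℂ → ℂ) (z : ℂ) :
    pull (affine a b) (fun w => p w - q w) z =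
      pull (affine a b) p z - pull (affine a b) q z := by
  simp only [pull_affine]; ring

theorem aemeasurable_comp_affine {a : ℂ} (ha : a ≠ 0) (b : ℂ) {E : Type*} [MeasurableSpace E]
    {g : ℂ → E} (hg : AEMeasurable g) : AEMeasurable (fun z => g (a * z + b)) := by
  have hq : Measure.QuasiMeasurePreserving (fun z : ℂ => a * z + b) volume volume := by
    refine ⟨by fun_prop, ?_⟩
    refine Measure.AbsolutelyContinuous.mk fun s hs h0 => ?_
    rw [Measure.map_apply (by fun_prop) hs]
    have : (fun z : ℂ => a * z + b) ⁻¹' s ⊆ (fun w => (w - b) / a) '' s := by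
      intro z hz
      exact ⟨_, hz, by field_simp; ring⟩
    exact measure_mono_null this (volume_image_eq_zero (by fun_prop) h0)
  exact hg.comp_quasiMeasurePreserving hq

theorem aemeasurable_comp_add {q : ℂ → ℂ} (U : ℂ) (hq : AEMeasurable q) :
    AEMeasurable (fun z => q (z + U)) := by
  simpa using aemeasurable_comp_affine one_ne_zero U hq

theorem aemeasurable_pull_affine {a : ℂ} (ha : a ≠ 0) (b : ℂ) {q : ℂ → ℂ}
    (hq : AEMeasurable q) : AEMeasurable (pull (affine a b) q) :=
  ((aemeasurable_comp_affine ha b hq).mul_const (a ^ 2)).congr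
    (ae_of_all _ fun z => (pull_affine a b q z).symm)

theorem mass_add_le (p q : ℂ → ℂ) (hp : AEMeasurable p) :
    mass (fun z => p z + q z) ≤ mass p + mass q := by
  rw [mass, mass, mass, ← lintegral_add_left' hp.enorm]
  exact lintegral_mono fun z => enorm_add_le _ _

theorem mass_sub_le (p r q : ℂ → ℂ) (hp : AEMeasurable p) (hr : AEMeasurable r) :
    mass (fun z => p z - q z) ≤ mass (fun z => p z - r z) + mass (fun z => r z - q z) := by
  have := mass_add_le (fun z => p z - r z) (fun z => r z - q z) (hp.sub hr)
  simpa using this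

/-! ### Fibres of the cosine -/

/-- The affine symmetries `z ↦ ±z + 2πk` of the cosine. -/
noncomputable def cosSymm (i : ℤ × Bool) (z : ℂ) : ℂ :=
  (if i.2 then 1 else -1) * z + 2 * i.1 * (Real.pi : ℂ)

theorem cos_cosSymm (i : ℤ × Bool) (z : ℂ) : Complex.cos (cosSymm i z) = Complex.cos z := by
  rw [eq_comm, Complex.cos_eq_cos_iff]
  rcases i with ⟨k, _ | _⟩
  · exact ⟨k, Or.inr (by simp [cosSymm]; ring)⟩
  · exact ⟨k, Or.inl (by simp [cosSymm]; ring)⟩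

theorem sin_sq_eq_of_cos_eq {z w : ℂ} (h : Complex.cos z = Complex.cos w) :
    Complex.sin z ^ 2 = Complex.sin w ^ 2 := by
  rw [Complex.sin_sq, Complex.sin_sq, h]

theorem exists_cosSymm_eq {z w : ℂ} (h : Complex.cos w = Complex.cos z) :
    ∃ i, cosSymm i z = w := by
  obtain ⟨k, hk | hk⟩ := Complex.cos_eq_cos_iff.1 h.symm
  · exact ⟨(k, true), by simp [cosSymm, hk]; ring⟩
  · exact ⟨(k, false), by simp [cosSymm, hk]; ring⟩

/-- A translation and a reflection can agree at `z` only if `z ∈ πℤ`, that is, at a critical point.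
-/
theorem cosSymm_injective {z : ℂ} (hz : Complex.sin z ≠ 0) :
    Function.Injective (fun i => cosSymm i z) := by
  have hpi : (Real.pi : ℂ) ≠ 0 := by exact_mod_cast Real.pi_ne_zero
  have key : ∀ k l : ℤ, (z + 2 * k * (Real.pi : ℂ) ≠ -z + 2 * l * (Real.pi : ℂ)) := by
    intro k l h
    refine hz (Complex.sin_eq_zero_iff.2 ⟨l - k, ?_⟩)
    push_cast
    linear_combination h / 2
  rintro ⟨k, _ | _⟩ ⟨l, _ | _⟩ h
  · simp only [cosSymm, if_false, Bool.false_eq_true] at h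
    have : ((k : ℂ) - l) * Real.pi = 0 := by linear_combination h / 2
    have := (mul_eq_zero.1 this).resolve_right hpi
    have : k = l := by exact_mod_cast sub_eq_zero.1 this
    rw [this]
  · exact absurd (by simpa [cosSymm] using h.symm) (key l k)
  · exact absurd (by simpa [cosSymm] using h) (key k l)
  · simp only [cosSymm, if_true] at h
    have : ((k : ℂ) - l) * Real.pi = 0 := by linear_combination h / 2
    have := (mul_eq_zero.1 this).resolve_right hpi
    have : k = l := by exact_mod_cast sub_eq_zero.1 this
    rw [this]

/-- The fibre of the cosine through a non-critical point, indexed by the symmetries. -/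
noncomputable def cosFibreEquiv {z : ℂ} (hz : Complex.sin z ≠ 0) :
    ℤ × Bool ≃ {x : ℂ // Complex.cos x = Complex.cos z} :=
  Equiv.ofBijective (fun i => ⟨cosSymm i z, cos_cosSymm i z⟩)
    ⟨fun _ _ h => cosSymm_injective hz (congrArg Subtype.val h), fun ⟨_, hw⟩ =>
      (exists_cosSymm_eq hw).imp fun _ hi => Subtype.ext hi⟩

theorem coe_cosFibreEquiv {z : ℂ} (hz : Complex.sin z ≠ 0) (i : ℤ × Bool) :
    (cosFibreEquiv hz i : ℂ) = cosSymm i z := rfl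

/-- `sin²` is constant on fibres of the cosine, so it leaves the sum. -/
theorem push_cos_cos (q : ℂ → ℂ) {z : ℂ} (hz : Complex.sin z ≠ 0) :
    push Complex.cos q (Complex.cos z) = (∑' i, q (cosSymm i z)) / Complex.sin z ^ 2 := by
  rw [push_cos, ← (cosFibreEquiv hz).tsum_eq, ← tsum_div_const]
  refine tsum_congr fun i => ?_
  rw [coe_cosFibreEquiv, sin_sq_eq_of_cos_eq (cos_cosSymm i z)]

theorem summable_cosSymm_iff (q : ℂ → ℂ) {z : ℂ} (hz : Complex.sin z ≠ 0) :
    Summable (fun i => q (cosSymm i z)) ↔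
      Summable (fun x : {x : ℂ // Complex.cos x = Complex.cos z} => q x) :=
  (cosFibreEquiv hz).summable_iff (f := fun x : {x : ℂ // Complex.cos x = Complex.cos z} => q x)

/-- The strip `0 < Re z < π`, a fundamental domain for the symmetries of the cosine. -/
def strip : Set ℂ := {z | 0 < z.re ∧ z.re < Real.pi}

theorem measurableSet_strip : MeasurableSet strip :=
  (measurableSet_lt measurable_const Complex.measurable_re).inter
    (measurableSet_lt Complex.measurable_re measurable_const)

theorem sin_ne_zero_of_re_ne {z : ℂ} (hz : ∀ k : ℤ, z.re ≠ k * Real.pi) : Complex.sin z ≠ 0 := by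
  intro h
  obtain ⟨k, hk⟩ := Complex.sin_eq_zero_iff.1 h
  exact hz k (by rw [hk, ← Complex.ofReal_intCast, ← Complex.ofReal_mul, Complex.ofReal_re])

theorem re_ne_of_mem_strip {z : ℂ} (hz : z ∈ strip) (k : ℤ) : z.re ≠ k * Real.pi := by
  intro h
  have h1 := hz.1
  have h2 := hz.2
  rw [h] at h1 h2
  have hpi := Real.pi_pos
  have h3 : (0 : ℝ) < k := by
    by_contra hk
    exact absurd h1 (not_lt.2 (mul_nonpos_of_nonpos_of_nonneg (not_lt.1 hk) hpi.le))
  have h4 : (k : ℝ) < 1 := by nlinarith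
  have h3' : 0 < k := by exact_mod_cast h3
  have h4' : k < 1 := by exact_mod_cast h4
  omega

theorem sin_ne_zero_of_mem_strip {z : ℂ} (hz : z ∈ strip) : Complex.sin z ≠ 0 :=
  sin_ne_zero_of_re_ne (re_ne_of_mem_strip hz)

theorem cosSymm_re (i : ℤ × Bool) (z : ℂ) :
    (cosSymm i z).re = (if i.2 then 1 else -1) * z.re + 2 * i.1 * Real.pi := by
  rcases i with ⟨k, _ | _⟩ <;> simp [cosSymm]

/-- Compare real parts: equal signs force `|k - l| < 1`, while opposite signs force an integer
strictly between 0 and 1. -/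
theorem eq_of_cosSymm_mem_strip {z w : ℂ} (hz : z ∈ strip) (hw : w ∈ strip) {i j : ℤ × Bool}
    (h : cosSymm i z = cosSymm j w) : i = j ∧ z = w := by
  have hpi := Real.pi_pos
  have hre := congrArg Complex.re h
  rw [cosSymm_re, cosSymm_re] at hre
  obtain ⟨hz1, hz2⟩ := hz
  obtain ⟨hw1, hw2⟩ := hw
  have aux : ∀ m : ℤ, -1 < (m : ℝ) → (m : ℝ) < 1 → m = 0 := by
    intro m h1 h2
    have h1' : -1 < m := by exact_mod_cast h1
    have h2' : m < 1 := by exact_mod_cast h2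
    omega
  rcases i with ⟨k, _ | _⟩ <;> rcases j with ⟨l, _ | _⟩ <;>
    simp only [if_true, if_false, Bool.false_eq_true] at hre
  · have := aux (k - l) (by push_cast; nlinarith) (by push_cast; nlinarith)
    obtain rfl : k = l := by omega
    exact ⟨rfl, by simpa [cosSymm] using h⟩
  · exfalso
    have h1 : (0 : ℝ) < ((k - l : ℤ) : ℝ) := by push_cast; nlinarith
    have h2 : ((k - l : ℤ) : ℝ) < 1 := by push_cast; nlinarith
    have := aux (k - l) (by linarith) h2
    rw [this] at h1; simp at h1
  · exfalso
    have h1 : (0 : ℝ) < ((l - k : ℤ) : ℝ) := by push_cast; nlinarith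
    have h2 : ((l - k : ℤ) : ℝ) < 1 := by push_cast; nlinarith
    have := aux (l - k) (by linarith) h2
    rw [this] at h1; simp at h1
  · have := aux (k - l) (by push_cast; nlinarith) (by push_cast; nlinarith)
    obtain rfl : k = l := by omega
    exact ⟨rfl, by simpa [cosSymm] using h⟩

theorem injOn_cos_strip : Set.InjOn Complex.cos strip := by
  intro z hz w hw h
  obtain ⟨i, hi⟩ := exists_cosSymm_eq h
  have h0 : cosSymm (0, true) z = z := by simp [cosSymm]
  exact (eq_of_cosSymm_mem_strip hw hz (hi.trans h0.symm)).2.symm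

theorem volume_setOf_re_eq (c : ℝ) : volume {z : ℂ | z.re = c} = 0 := by
  have h := Complex.volume_preserving_equiv_real_prod.measure_preimage
    (s := {c} ×ˢ Set.univ) ((measurableSet_singleton c).prod MeasurableSet.univ).nullMeasurableSet
  have : Complex.measurableEquivRealProd ⁻¹' ({c} ×ˢ Set.univ) = {z : ℂ | z.re = c} := by
    ext z; simp [Complex.measurableEquivRealProd]
  rw [this] at h
  rw [h, Measure.volume_eq_prod, Measure.prod_prod]
  simp

theorem ae_re_ne : ∀ᵐ z : ℂ, ∀ k : ℤ, z.re ≠ k * Real.pi := by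
  rw [ae_all_iff]
  intro k
  rw [ae_iff]
  simpa using volume_setOf_re_eq (k * Real.pi)

theorem exists_mem_strip {z : ℂ} (hz : ∀ k : ℤ, z.re ≠ k * Real.pi) :
    ∃ i, ∃ w ∈ strip, cosSymm i w = z := by
  have hpi := Real.pi_pos
  set m : ℤ := ⌊z.re / Real.pi⌋ with hm
  have h1 : m * Real.pi < z.re := by
    refine lt_of_le_of_ne ?_ (hz m).symm
    rw [← le_div_iff₀ hpi]; exact Int.floor_le _
  have h2 : z.re < (m + 1) * Real.pi := by
    rw [← div_lt_iff₀ hpi]; exact Int.lt_floor_add_one _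
  obtain ⟨k, hk | hk⟩ := Int.even_or_odd' m
  · refine ⟨(k, true), z - 2 * k * (Real.pi : ℂ), ?_, by simp [cosSymm]⟩
    rw [hk] at h1 h2
    push_cast at h1 h2
    have : (z - 2 * k * (Real.pi : ℂ)).re = z.re - 2 * k * Real.pi := by simp
    constructor <;> rw [this] <;> nlinarith
  · refine ⟨(k + 1, false), -z + 2 * (k + 1) * (Real.pi : ℂ), ?_, by simp [cosSymm]⟩
    rw [hk] at h1 h2
    push_cast at h1 h2
    have : (-z + 2 * (k + 1) * (Real.pi : ℂ)).re = -z.re + 2 * (k + 1) * Real.pi := by simp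
    constructor <;> rw [this] <;> nlinarith

/-- Only the image of the lines `Re z ∈ πℤ` can be missed, and differentiable maps preserve null
sets. -/
theorem volume_compl_image_cos_strip : volume (Complex.cos '' strip)ᶜ = 0 := by
  refine measure_mono_null ?_ (volume_image_eq_zero Complex.differentiable_cos ae_re_ne)
  intro w hw
  obtain ⟨z, rfl⟩ := Complex.cos_surjective w
  refine ⟨z, fun hz => hw ?_, rfl⟩
  obtain ⟨i, u, hu, rfl⟩ := exists_mem_strip hz
  exact ⟨u, hu, (cos_cosSymm i u).symm⟩

theorem lintegral_eq_lintegral_strip_cos (g : ℂ → ℝ≥0∞) :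
    ∫⁻ w, g w = ∫⁻ z in strip, ‖Complex.sin z‖ₑ ^ 2 * g (Complex.cos z) := by
  have h := lintegral_image_eq_of_hasDerivAt measurableSet_strip
    (fun z _ => Complex.hasDerivAt_cos z) injOn_cos_strip g
  simp only [enorm_neg] at h
  rw [← h, Measure.restrict_eq_self_of_ae_mem]
  exact volume_compl_image_cos_strip

theorem ae_of_ae_cos {P : ℂ → Prop} (h : ∀ᵐ z ∂(volume.restrict strip), P (Complex.cos z)) :
    ∀ᵐ w, P w := by
  rw [ae_restrict_iff' measurableSet_strip] at h
  have h1 := volume_image_eq_zero Complex.differentiable_cos h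
  refine measure_mono_null ?_ (measure_union_null h1 volume_compl_image_cos_strip)
  intro w hw
  by_cases hs : w ∈ Complex.cos '' strip
  · obtain ⟨z, hz, rfl⟩ := hs
    exact Or.inl ⟨z, fun hh => hw (hh hz), rfl⟩
  · exact Or.inr hs

theorem aemeasurable_comp_cosSymm {E : Type*} [MeasurableSpace E] {g : ℂ → E}
    (hg : AEMeasurable g) (i : ℤ × Bool) : AEMeasurable (fun z => g (cosSymm i z)) :=
  aemeasurable_comp_affine (by split_ifs <;> simp) _ hg

/-- Unfolding: the images of the strip under the symmetries are disjoint and tile the plane up to a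
null set. -/
theorem lintegral_eq_lintegral_strip_tsum {g : ℂ → ℝ≥0∞} (hg : AEMeasurable g) :
    ∫⁻ z, g z = ∫⁻ z in strip, ∑' i, g (cosSymm i z) := by
  rw [lintegral_tsum fun i => (aemeasurable_comp_cosSymm hg i).restrict]
  have hone : ∀ i : ℤ × Bool, ‖(if i.2 then 1 else -1 : ℂ)‖ₑ = 1 := by
    intro i; split_ifs <;> simp
  have hd : ∀ i z, HasDerivAt (cosSymm i) (if i.2 then 1 else -1 : ℂ) z := fun i z => by
    have := ((hasDerivAt_id z).const_mul (if i.2 then 1 else -1 : ℂ)).add_const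
      (2 * i.1 * (Real.pi : ℂ))
    rwa [mul_one] at this
  have hi : ∀ i, Set.InjOn (cosSymm i) strip := fun i z hz w hw h =>
    (eq_of_cosSymm_mem_strip hz hw h).2
  have himg : ∀ i, ∫⁻ z in strip, g (cosSymm i z) = ∫⁻ z in cosSymm i '' strip, g z := by
    intro i
    rw [lintegral_image_eq_of_hasDerivAt measurableSet_strip (fun z _ => hd i z) (hi i)]
    simp [hone]
  simp_rw [himg]
  rw [← lintegral_iUnion
    (fun i => measurableSet_image_of_hasDerivAt measurableSet_strip (fun z _ => hd i z) (hi i)),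
    Measure.restrict_eq_self_of_ae_mem]
  · filter_upwards [ae_re_ne] with z hz
    obtain ⟨i, w, hw, h⟩ := exists_mem_strip hz
    exact Set.mem_iUnion.2 ⟨i, w, hw, h⟩
  · intro i j hij
    rw [Function.onFun, Set.disjoint_left]
    rintro _ ⟨z, hz, rfl⟩ ⟨w, hw, h⟩
    exact hij (eq_of_cosSymm_mem_strip hw hz h).1.symm

/-! ### Mass, linearity and measurability of the push-forward -/

theorem enorm_sin_sq_mul_push_cos (q : ℂ → ℂ) {z : ℂ} (hz : z ∈ strip) :
    ‖Complex.sin z‖ₑ ^ 2 * ‖push Complex.cos q (Complex.cos z)‖ₑ = ‖∑' i, q (cosSymm i z)‖ₑ := by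
  rw [push_cos_cos q (sin_ne_zero_of_mem_strip hz), ← enorm_pow, ← enorm_mul,
    mul_div_cancel₀ _ (pow_ne_zero 2 (sin_ne_zero_of_mem_strip hz))]

/-- Push-forward under the cosine does not increase the mass. -/
theorem mass_push_cos_le {q : ℂ → ℂ} (hq : AEMeasurable q) :
    mass (push Complex.cos q) ≤ mass q := by
  rw [mass, lintegral_eq_lintegral_strip_cos, mass, lintegral_eq_lintegral_strip_tsum hq.enorm]
  refine setLIntegral_mono' measurableSet_strip fun z hz => ?_
  rw [enorm_sin_sq_mul_push_cos q hz]
  exact enorm_tsum_le_tsum_enorm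

theorem ae_summable_cosSymm {q : ℂ → ℂ} (hq : AEMeasurable q) (hm : mass q ≠ ∞) :
    ∀ᵐ z ∂(volume.restrict strip), Summable fun i => q (cosSymm i z) := by
  rw [mass, lintegral_eq_lintegral_strip_tsum hq.enorm] at hm
  have := ae_lt_top' (AEMeasurable.tsum
    fun i => (aemeasurable_comp_cosSymm hq.enorm i).restrict) hm
  filter_upwards [this] with z hz
  exact (tsum_enorm_ne_top_iff_summable_norm.1 hz.ne).of_norm

/-- Finite mass gives summability over almost every fibre; elsewhere `tsum` takes its default value
and additivity may fail. -/
theorem push_cos_sub_ae {p q : ℂ → ℂ} (hp : AEMeasurable p) (hq : AEMeasurable q)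
    (hpm : mass p ≠ ∞) (hqm : mass q ≠ ∞) :
    ∀ᵐ w, push Complex.cos (fun z => p z - q z) w =
      push Complex.cos p w - push Complex.cos q w := by
  apply ae_of_ae_cos
  filter_upwards [ae_summable_cosSymm hp hpm, ae_summable_cosSymm hq hqm,
    ae_restrict_mem measurableSet_strip] with z h1 h2 hz
  have hs := sin_ne_zero_of_mem_strip hz
  rw [push_cos_cos _ hs, push_cos_cos _ hs, push_cos_cos _ hs, h1.tsum_sub h2, sub_div]

theorem mass_push_cos_sub_le {p q : ℂ → ℂ} (hp : AEMeasurable p) (hq : AEMeasurable q)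
    (hpm : mass p ≠ ∞) (hqm : mass q ≠ ∞) :
    mass (fun w => push Complex.cos p w - push Complex.cos q w) ≤ mass (fun z => p z - q z) := by
  refine le_trans (le_of_eq ?_) (mass_push_cos_le (hp.sub hq))
  refine lintegral_congr_ae ?_
  filter_upwards [push_cos_sub_ae hp hq hpm hqm] with w hw
  rw [← hw]

/-- The principal branch of `arccos w = -i log (w + i √(1 - w²))` is measurable despite its
discontinuities. -/
theorem exists_measurable_rightInverse_cos :
    ∃ A : ℂ → ℂ, Measurable A ∧ ∀ w, Complex.cos (A w) = w := by
  refine ⟨fun w => -Complex.I * Complex.log (w + Complex.I * (1 - w ^ 2) ^ (1 / 2 : ℂ)),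
    by fun_prop, fun w => ?_⟩
  set s := (1 - w ^ 2 : ℂ) ^ (1 / 2 : ℂ) with hs
  have hs2 : s ^ 2 = 1 - w ^ 2 := by
    rw [hs, one_div]
    simp
  have hI := Complex.I_sq
  have hprod : (w + Complex.I * s) * (w - Complex.I * s) = 1 := by
    linear_combination hs2 - s ^ 2 * hI
  have h0 : w + Complex.I * s ≠ 0 := left_ne_zero_of_mul_eq_one hprod
  have e1 : -Complex.I * Complex.log (w + Complex.I * s) * Complex.I =
      Complex.log (w + Complex.I * s) := by
    linear_combination -Complex.log (w + Complex.I * s) * hI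
  rw [Complex.cos, neg_mul (-Complex.I * Complex.log (w + Complex.I * s)) Complex.I, Complex.exp_neg,
    e1, Complex.exp_log h0, inv_eq_of_mul_eq_one_right hprod]
  ring

/-- The fibre sum may be based at any point of the fibre, so it is based at the measurable choice `A
w`; it is then an a.e. limit of measurable finite sums. -/
theorem aemeasurable_push_cos {q : ℂ → ℂ} (hq : AEMeasurable q) (hm : mass q ≠ ∞) :
    AEMeasurable (push Complex.cos q) := by
  obtain ⟨A, hA, hcos⟩ := exists_measurable_rightInverse_cos
  -- Composition with `A` requires a genuinely measurable representative.
  let q' := hq.mk q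
  have hq' : Measurable q' := hq.measurable_mk
  have hqq : q =ᵐ[volume] q' := hq.ae_eq_mk
  have hm' : mass q' ≠ ∞ := by
    have : mass q' = mass q := lintegral_congr_ae (by filter_upwards [hqq] with z hz; rw [hz])
    rwa [this]
  have hsin : ∀ z ∈ strip, Complex.sin (A (Complex.cos z)) ≠ 0 := by
    intro z hz h0
    have h := sin_sq_eq_of_cos_eq (hcos (Complex.cos z))
    rw [h0, zero_pow two_ne_zero] at h
    exact pow_ne_zero 2 (sin_ne_zero_of_mem_strip hz) h.symm
  have hsum : ∀ᵐ w, Summable (fun i => q' (cosSymm i (A w))) := by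
    apply ae_of_ae_cos
    filter_upwards [ae_summable_cosSymm hq'.aemeasurable hm',
      ae_restrict_mem measurableSet_strip] with z h1 hz
    rw [summable_cosSymm_iff q' (sin_ne_zero_of_mem_strip hz)] at h1
    rw [summable_cosSymm_iff q' (hsin z hz), hcos]
    exact h1
  have hS : AEMeasurable (fun w => (∑' i, q' (cosSymm i (A w))) / (1 - w ^ 2)) := by
    refine AEMeasurable.div ?_ (by fun_prop)
    refine aemeasurable_of_tendsto_metrizable_ae atTop
      (f := fun (s : Finset (ℤ × Bool)) w => ∑ i ∈ s, q' (cosSymm i (A w))) (fun s => ?_) ?_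
    · refine Measurable.aemeasurable (Finset.measurable_sum _ fun i _ => hq'.comp ?_)
      unfold cosSymm
      fun_prop
    · filter_upwards [hsum] with w hw using hw.hasSum
  refine hS.congr ?_
  have hall : ∀ᵐ z, ∀ i, q (cosSymm i z) = q' (cosSymm i z) := by
    rw [ae_all_iff]
    intro i
    -- The index is that of the inverse symmetry: reflections are involutions, translations change
    -- sign.
    have hN : ∀ᵐ z ∂(volume : Measure ℂ), z ∈ cosSymm (if i.2 then (-i.1, true) else i) ''
        {w | q w ≠ q' w} → False := by
      have h0 : volume {w | q w ≠ q' w} = 0 := hqq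
      have := volume_image_eq_zero
        (f := cosSymm (if i.2 then (-i.1, true) else i)) (by unfold cosSymm; fun_prop) h0
      exact measure_eq_zero_iff_ae_notMem.1 this
    filter_upwards [hN] with z hz
    by_contra hne
    refine hz ⟨cosSymm i z, hne, ?_⟩
    rcases i with ⟨k, _ | _⟩ <;> simp [cosSymm]
  apply ae_of_ae_cos
  filter_upwards [ae_restrict_of_ae hall, ae_restrict_mem measurableSet_strip] with z h1 hz
  have hpq : push Complex.cos q (Complex.cos z) = push Complex.cos q' (Complex.cos z) := by
    rw [push_cos_cos q (sin_ne_zero_of_mem_strip hz), push_cos_cos q' (sin_ne_zero_of_mem_strip hz)]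
    simp_rw [h1]
  have h2 := push_cos_cos q' (hsin z hz)
  rw [Complex.sin_sq, hcos] at h2
  rw [hpq, h2]

/-! ### The cosine away from its critical points -/

theorem FarFromCritical.sin_ne_zero {δ : ℝ} (hδ : 0 < δ) {b : ℂ} (hb : FarFromCritical δ b) :
    Complex.sin b ≠ 0 := by
  intro h
  obtain ⟨k, hk⟩ := Complex.sin_eq_zero_iff.1 h
  have := hb k
  rw [hk, sub_self, norm_zero] at this
  linarith

theorem FarFromCritical.mono {δ δ' : ℝ} (h : δ' ≤ δ) {b : ℂ} (hb : FarFromCritical δ b) :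
    FarFromCritical δ' b := fun k => h.trans (hb k)

theorem FarFromCritical.sub_dist {δ : ℝ} {w b : ℂ} (hw : FarFromCritical δ w) :
    FarFromCritical (δ - ‖w - b‖) b := by
  intro k
  have h1 := hw k
  have h2 := norm_sub_le_norm_sub_add_norm_sub w b (k * (Real.pi : ℂ))
  linarith

/-- Two points of one fibre differ by a multiple of `2π`, too long for the ball unless zero, or have
a critical point `kπ` as midpoint, which would lie in the ball. -/
theorem FarFromCritical.injOn_cos {δ : ℝ} (hδ : δ ≤ 1) {b : ℂ} (hb : FarFromCritical δ b) :
    Set.InjOn Complex.cos (Metric.ball b δ) := by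
  intro z hz w hw h
  rw [mem_ball_iff_norm] at hz hw
  obtain ⟨k, hk | hk⟩ := Complex.cos_eq_cos_iff.1 h
  · have h1 : ‖(2 * k * Real.pi : ℂ)‖ < 2 := by
      have : (2 * k * Real.pi : ℂ) = (w - b) - (z - b) := by rw [hk]; ring
      rw [this]
      linarith [norm_sub_le (w - b) (z - b)]
    have h2 : ‖(2 * k * Real.pi : ℂ)‖ = 2 * |(k : ℝ)| * Real.pi := by
      simp [abs_of_pos Real.pi_pos]
    have hk0 : k = 0 := by
      by_contra hne
      have : (1 : ℝ) ≤ |(k : ℝ)| := by exact_mod_cast Int.one_le_abs hne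
      nlinarith [Real.pi_gt_three]
    simpa [hk0] using hk.symm
  · exfalso
    have h1 := hb k
    have h2 : b - k * (Real.pi : ℂ) = -((z - b) + (w - b)) / 2 := by rw [hk]; ring
    rw [h2, norm_div, norm_neg] at h1
    have := norm_add_le (z - b) (w - b)
    simp at h1
    linarith

theorem exists_cot_bound {δ : ℝ} (hδ : 0 < δ) :
    ∃ K : ℝ, ∀ b, FarFromCritical δ b → ‖Complex.cos b / Complex.sin b‖ ≤ K := by
  set m := min (1 / 2) δ with hm
  have hm0 : 0 < m := by positivity
  refine ⟨1 + 2 / m, fun b hb => ?_⟩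
  have hs := hb.sin_ne_zero hδ
  set u := Complex.exp (2 * b * Complex.I) - 1 with hu
  -- If `u` is small, `2ib` is `log (1 + u)` modulo `2πi`, and `|log (1 + u)| ≤ (3/2)|u|` puts `b`
  -- within `δ` of some `kπ`.
  have hum : m ≤ ‖u‖ := by
    by_contra! hlt
    have hu2 : ‖u‖ ≤ 1 / 2 := hlt.le.trans (min_le_left _ _)
    have hlog := Complex.norm_log_one_add_half_le_self hu2
    have hne : 1 + u ≠ 0 := by rw [hu]; simp
    have hexp : Complex.exp (2 * b * Complex.I) = Complex.exp (Complex.log (1 + u)) := by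
      rw [Complex.exp_log hne, hu]; ring
    obtain ⟨k, hk⟩ := Complex.exp_eq_exp_iff_exists_int.1 hexp
    have h1 := hb k
    have h2 : b - k * (Real.pi : ℂ) = Complex.log (1 + u) * (-Complex.I / 2) := by
      linear_combination (-Complex.I / 2) * hk - (k * (Real.pi : ℂ) - b) * Complex.I_sq
    rw [h2, norm_mul] at h1
    simp at h1
    have h3 : m ≤ δ := min_le_right _ _
    linarith
  have hu0 : 0 < ‖u‖ := hm0.trans_le hum
  have hrel : Complex.cos b * u = Complex.I * (u + 2) * Complex.sin b := by
    have h1 : Complex.exp (2 * b * Complex.I) = Complex.exp (b * Complex.I) ^ 2 := by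
      rw [← Complex.exp_nat_mul]; congr 1; push_cast; ring
    have h2 : Complex.exp (-b * Complex.I) * Complex.exp (b * Complex.I) = 1 := by
      rw [← Complex.exp_add]; simp
    rw [hu, h1, Complex.cos, Complex.sin]
    set E := Complex.exp (b * Complex.I)
    set E' := Complex.exp (-b * Complex.I)
    linear_combination (-(E ^ 2 + 1) * (E' - E) / 2) * Complex.I_sq + E * h2
  -- In this form the lower bound on `|u|` bounds the cotangent.
  have hquot : Complex.cos b / Complex.sin b = Complex.I * (1 + 2 / u) := by
    have : u ≠ 0 := norm_pos_iff.1 hu0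
    field_simp
    linear_combination hrel
  rw [hquot, norm_mul, Complex.norm_I, one_mul]
  refine (norm_add_le _ _).trans ?_
  rw [norm_one, norm_div, Complex.norm_two]
  gcongr

/-! ### Push-forwards of test functions under the rescaled cosine -/

/-- If `F n → id` on a ball containing the support of `φ` and `G n` is the push-forward of `φ`
restricted to the ball under `F n`, then `G n → φ` in mass. -/
theorem tendsto_mass_sub_of_push {φ : ℂ → ℂ} (hφ : Continuous φ) {R M C : ℝ}
    (hsupp : ∀ z ∉ Metric.ball 0 R, φ z = 0) (hM : ∀ z, ‖φ z‖ ≤ M) {F F' G : ℕ → ℂ → ℂ}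
    (hFm : ∀ n, Measurable (F n)) (hFm' : ∀ n, Measurable (F' n))
    (hd : ∀ᶠ n in atTop, ∀ z ∈ Metric.ball 0 R, HasDerivAt (F n) (F' n z) z)
    (hinj : ∀ᶠ n in atTop, Set.InjOn (F n) (Metric.ball 0 R))
    (hG : ∀ᶠ n in atTop, ∀ z ∈ Metric.ball 0 R, G n (F n z) * F' n z ^ 2 = φ z)
    (hG0 : ∀ᶠ n in atTop, ∀ w ∉ F n '' Metric.ball 0 R, G n w = 0)
    (hF : ∀ z, Tendsto (fun n => F n z) atTop (𝓝 z))
    (hF' : ∀ z, Tendsto (fun n => F' n z) atTop (𝓝 1))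
    (hC : ∀ᶠ n in atTop, ∀ z ∈ Metric.ball 0 R, ‖F' n z‖ ≤ C) :
    Tendsto (fun n => mass (fun w => G n w - φ w)) atTop (𝓝 0) := by
  set B : Set ℂ := Metric.ball 0 R with hB
  have hBm : MeasurableSet B := Metric.isOpen_ball.measurableSet
  have hBfin : volume B ≠ ∞ := measure_ball_lt_top.ne
  have hM0 : 0 ≤ M := (norm_nonneg _).trans (hM 0)
  have hlim : ∀ z, Tendsto (fun n => φ (F n z) * F' n z ^ 2) atTop (𝓝 (φ z)) := fun z => by
    simpa using ((hφ.tendsto z).comp (hF z)).mul ((hF' z).pow 2)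
  have hmeas : ∀ n, Measurable (fun z => φ (F n z) * F' n z ^ 2) := fun n =>
    (hφ.measurable.comp (hFm n)).mul ((hFm' n).pow_const 2)
  have hbd : ∀ᶠ n in atTop, ∀ z ∈ B, ‖φ (F n z) * F' n z ^ 2‖ ≤ M * C ^ 2 := by
    filter_upwards [hC] with n hn z hz
    rw [norm_mul, norm_pow]
    gcongr
    exacts [hM _, hn z hz]
  have h1 : Tendsto (fun n => ∫⁻ z in B, ‖φ z - φ (F n z) * F' n z ^ 2‖ₑ) atTop (𝓝 0) := by
    have := tendsto_lintegral_filter_of_dominated_convergence (μ := volume.restrict B)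
      (F := fun n z => ‖φ z - φ (F n z) * F' n z ^ 2‖ₑ) (l := atTop) (f := fun _ => 0)
      (fun _ => ENNReal.ofReal (M + M * C ^ 2))
      (Eventually.of_forall fun n => (hφ.measurable.sub (hmeas n)).enorm) ?_ ?_ ?_
    · simpa using this
    · filter_upwards [hbd] with n hn
      filter_upwards [ae_restrict_mem hBm] with z hz
      rw [← ofReal_norm]
      refine ENNReal.ofReal_le_ofReal ((norm_sub_le _ _).trans ?_)
      exact add_le_add (hM z) (hn z hz)
    · simpa using ENNReal.mul_ne_top ENNReal.ofReal_ne_top hBfin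
    · refine ae_of_all _ fun z => ?_
      have := ((tendsto_const_nhds (x := φ z)).sub (hlim z)).enorm
      simpa using this
  have hmassB : mass φ = ∫⁻ z in B, ‖φ z‖ₑ := by
    rw [mass, ← setLIntegral_eq_of_support_subset]
    intro z hz
    by_contra hzB
    exact hz (by simp [hsupp z hzB])
  have hmfin : mass φ ≠ ∞ := by
    rw [hmassB]
    refine ne_top_of_le_ne_top (b := ENNReal.ofReal M * volume B)
      (ENNReal.mul_ne_top ENNReal.ofReal_ne_top hBfin) ?_
    rw [← setLIntegral_const]
    refine lintegral_mono fun z => ?_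
    rw [← ofReal_norm]
    exact ENNReal.ofReal_le_ofReal (hM z)
  have h2 : Tendsto (fun n => ∫⁻ z in B, ‖φ (F n z) * F' n z ^ 2‖ₑ) atTop (𝓝 (mass φ)) := by
    rw [hmassB]
    refine tendsto_lintegral_filter_of_dominated_convergence (μ := volume.restrict B)
      (fun _ => ENNReal.ofReal (M * C ^ 2))
      (Eventually.of_forall fun n => (hmeas n).enorm) ?_ ?_ ?_
    · filter_upwards [hbd] with n hn
      filter_upwards [ae_restrict_mem hBm] with z hz
      rw [← ofReal_norm]
      exact ENNReal.ofReal_le_ofReal (hn z hz)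
    · simpa using ENNReal.mul_ne_top ENNReal.ofReal_ne_top hBfin
    · exact ae_of_all _ fun z => (hlim z).enorm
  have h3 : Tendsto (fun n => mass φ - ∫⁻ z in B, ‖φ (F n z) * F' n z ^ 2‖ₑ) atTop (𝓝 0) := by
    simpa using ENNReal.Tendsto.sub (tendsto_const_nhds (x := mass φ)) h2 (Or.inl hmfin)
  have h4 := h1.add h3
  rw [add_zero] at h4
  refine (tendsto_congr' ?_).2 h4
  filter_upwards [hd, hinj, hG, hG0] with n hd hinj hG hG0
  have himg := measurableSet_image_of_hasDerivAt hBm hd hinj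
  -- On `F n '' B` a change of variables gives the integral of `h1`. Off it `G n = 0`, leaving the
  -- part of the mass of `φ` not captured by `F n '' B`, which is the difference in `h3`.
  rw [mass, ← lintegral_add_compl _ himg]
  congr 1
  · rw [lintegral_image_eq_of_hasDerivAt hBm hd hinj]
    refine setLIntegral_congr_fun hBm fun z hz => ?_
    rw [← enorm_pow, ← enorm_mul, ← hG z hz]
    congr 1; ring
  · have e1 : ∫⁻ z in B, ‖φ (F n z) * F' n z ^ 2‖ₑ = ∫⁻ w in F n '' B, ‖φ w‖ₑ := by
      rw [lintegral_image_eq_of_hasDerivAt hBm hd hinj]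
      simp_rw [enorm_mul, enorm_pow, mul_comm]
    have e2 : ∫⁻ w in (F n '' B)ᶜ, ‖G n w - φ w‖ₑ = ∫⁻ w in (F n '' B)ᶜ, ‖φ w‖ₑ := by
      refine setLIntegral_congr_fun himg.compl fun w hw => ?_
      simp only [hG0 w hw, zero_sub, enorm_neg]
    have e3 : mass φ = (∫⁻ w in F n '' B, ‖φ w‖ₑ) + ∫⁻ w in (F n '' B)ᶜ, ‖φ w‖ₑ :=
      (lintegral_add_compl _ himg).symm
    rw [e1, e2, e3, ENNReal.add_sub_cancel_left]
    exact ne_top_of_le_ne_top hmfin (by rw [e3]; exact le_self_add)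

/-- The cosine read in the scalings `z ↦ a z + b` of the source and
`z ↦ -a sin b z + cos b` of the target. -/
noncomputable def rescaledCos (a b z : ℂ) : ℂ :=
  (Complex.cos (a * z + b) - Complex.cos b) / (-a * Complex.sin b)

theorem hasDerivAt_rescaledCos {a b : ℂ} (ha : a ≠ 0) (z : ℂ) :
    HasDerivAt (rescaledCos a b) (Complex.sin (a * z + b) / Complex.sin b) z := by
  have h := (((((hasDerivAt_id z).const_mul a).add_const b).ccos).sub_const
    (Complex.cos b)).div_const (-a * Complex.sin b)
  refine h.congr_deriv ?_
  rw [mul_one, neg_mul, neg_mul, neg_div_neg_eq, mul_comm, mul_div_mul_left _ _ ha]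
  rfl

/-- The dependence on `b` is isolated in the cotangent; the other factors are difference quotients
at 0, with limits `z` and `0` as `a → 0`. -/
theorem rescaledCos_eq {a b : ℂ} (ha : a ≠ 0) (hb : Complex.sin b ≠ 0) (z : ℂ) :
    rescaledCos a b z = a⁻¹ * Complex.sin (a * z) -
      Complex.cos b / Complex.sin b * (a⁻¹ * (Complex.cos (a * z) - 1)) := by
  rw [rescaledCos, Complex.cos_add]
  field_simp
  ring

theorem deriv_rescaledCos_eq {a b : ℂ} (hb : Complex.sin b ≠ 0) (z : ℂ) :
    Complex.sin (a * z + b) / Complex.sin b = Complex.cos (a * z) +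
      Complex.cos b / Complex.sin b * Complex.sin (a * z) := by
  rw [Complex.sin_add]
  field_simp
  ring

theorem cos_eq_affine_iff {a b : ℂ} (ha : a ≠ 0) (hb : Complex.sin b ≠ 0) (z w : ℂ) :
    Complex.cos (a * z + b) = -a * Complex.sin b * w + Complex.cos b ↔ rescaledCos a b z = w := by
  rw [rescaledCos, div_eq_iff (mul_ne_zero (neg_ne_zero.2 ha) hb), sub_eq_iff_eq_add, mul_comm w]

theorem tendsto_mul_zero_of_bounded {K : ℝ} {c x : ℕ → ℂ} (hc : ∀ᶠ n in atTop, ‖c n‖ ≤ K)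
    (hx : Tendsto x atTop (𝓝 0)) : Tendsto (fun n => c n * x n) atTop (𝓝 0) := by
  have h : Tendsto (fun n => K * ‖x n‖) atTop (𝓝 0) := by simpa using hx.norm.const_mul K
  refine squeeze_zero_norm' ?_ h
  filter_upwards [hc] with n hn
  rw [norm_mul]
  gcongr

theorem tendsto_mass_pull_push_cos {φ : ℂ → ℂ} (hφ : Continuous φ) (hc : HasCompactSupport φ)
    {a b : ℕ → ℂ} (ha : Tendsto a atTop (𝓝 0)) (ha0 : ∀ᶠ n in atTop, a n ≠ 0) {δ : ℝ}
    (hδ : 0 < δ) (hb : ∀ᶠ n in atTop, FarFromCritical δ (b n)) :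
    Tendsto (fun n => mass (fun w =>
      pull (affine (-a n * Complex.sin (b n)) (Complex.cos (b n)))
        (push Complex.cos (pull (affine (a n)⁻¹ (-b n / a n)) φ)) w - φ w)) atTop (𝓝 0) := by
  wlog hδ1 : δ ≤ 1 generalizing δ
  · exact this (δ := 1) one_pos (hb.mono fun n hn => hn.mono (not_le.1 hδ1).le) le_rfl
  obtain ⟨K, hK⟩ := exists_cot_bound hδ
  have hK' : ∀ᶠ n in atTop, ‖Complex.cos (b n) / Complex.sin (b n)‖ ≤ K :=
    hb.mono fun n hn => hK _ hn
  have hsin : ∀ᶠ n in atTop, Complex.sin (b n) ≠ 0 := hb.mono fun n hn => hn.sin_ne_zero hδ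
  have haz : ∀ z, Tendsto (fun n => a n * z) atTop (𝓝 0) := fun z => by
    simpa using ha.mul_const z
  have ha' : Tendsto a atTop (𝓝[≠] 0) := tendsto_nhdsWithin_iff.2 ⟨ha, ha0⟩
  obtain ⟨M, hM⟩ := hc.exists_bound_of_continuous hφ
  obtain ⟨R, hR0, hR⟩ := hc.isCompact.isBounded.subset_ball_lt 0 0
  obtain ⟨C₁, hC₁⟩ := (isCompact_closedBall (0 : ℂ) 1).exists_bound_of_continuousOn
    Complex.continuous_cos.continuousOn
  obtain ⟨C₂, hC₂⟩ := (isCompact_closedBall (0 : ℂ) 1).exists_bound_of_continuousOn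
    Complex.continuous_sin.continuousOn
  have hsmall : ∀ᶠ n in atTop, ∀ z ∈ Metric.ball (0 : ℂ) R, ‖a n * z‖ < δ := by
    have : ∀ᶠ n in atTop, ‖a n‖ < δ / R := by
      have := ha.norm
      rw [norm_zero] at this
      exact this.eventually_lt_const (by positivity)
    filter_upwards [this] with n hn z hz
    rw [mem_ball_zero_iff] at hz
    rw [norm_mul]
    calc ‖a n‖ * ‖z‖ ≤ ‖a n‖ * R := by gcongr
      _ < δ / R * R := by gcongr
      _ = δ := by field_simp
  have hφ0 : ∀ z ∉ Metric.ball (0 : ℂ) R, φ z = 0 := fun z hz =>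
    image_eq_zero_of_notMem_tsupport fun h => hz (hR h)
  have hinj : ∀ᶠ n in atTop, Set.InjOn (rescaledCos (a n) (b n)) (Metric.ball 0 R) := by
    filter_upwards [ha0, hsin, hb, hsmall] with n hn hs hb hsm z hz w hw h
    have h1 := ((cos_eq_affine_iff hn hs z _).2 h).trans ((cos_eq_affine_iff hn hs w _).2 rfl).symm
    have h2 := hb.injOn_cos hδ1 (by simpa [mem_ball_iff_norm] using hsm z hz)
      (by simpa [mem_ball_iff_norm] using hsm w hw) h1
    simpa [hn] using h2
  refine tendsto_mass_sub_of_push hφ (R := R) (M := M) (C := C₁ + K * C₂) hφ0 hM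
    (F := fun n => rescaledCos (a n) (b n))
    (F' := fun n z => Complex.sin (a n * z + b n) / Complex.sin (b n))
    (fun n => by unfold rescaledCos; fun_prop) (fun n => by fun_prop) ?_ ?_ ?_ ?_ ?_ ?_ ?_
  · filter_upwards [ha0] with n hn z _ using hasDerivAt_rescaledCos hn z
  · exact hinj
  · filter_upwards [ha0, hsin, hb, hsmall, hinj] with n hn hs hb hsm hinj z hz
    have hcos := (cos_eq_affine_iff hn hs z _).2 rfl
    have hs1 : Complex.sin (a n * z + b n) ≠ 0 := by
      refine (hb.sub_dist (b := a n * z + b n)).sin_ne_zero ?_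
      rw [norm_sub_rev, add_sub_cancel_right]
      exact sub_pos.2 (hsm z hz)
    -- Injectivity on the ball leaves a single preimage at which the transported `φ` can be
    -- non-zero.
    rw [pull_affine, push_cos, tsum_eq_single ⟨a n * z + b n, hcos⟩]
    · rw [pull_affine]
      have : (a n)⁻¹ * (a n * z + b n) + -b n / a n = z := by field_simp; ring
      rw [this]
      field_simp
    · rintro ⟨x, hx⟩ hne
      rw [pull_affine, hφ0, zero_mul, zero_div]
      intro hmem
      have hx' : a n * ((a n)⁻¹ * x + -b n / a n) + b n = x := by field_simp; ring
      have h1 := (cos_eq_affine_iff hn hs _ (rescaledCos (a n) (b n) z)).1 (by rw [hx']; exact hx)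
      have h2 := hinj hmem hz h1
      exact hne (Subtype.ext (hx'.symm.trans (congrArg (fun t => a n * t + b n) h2)))
  · filter_upwards [ha0, hsin] with n hn hs w hw
    have h0 : ∀ x : {x : ℂ // Complex.cos x =
        -a n * Complex.sin (b n) * w + Complex.cos (b n)},
        pull (affine (a n)⁻¹ (-b n / a n)) φ x / Complex.sin x ^ 2 = 0 := by
      rintro ⟨x, hx⟩
      rw [pull_affine, hφ0, zero_mul, zero_div]
      intro hmem
      have hx' : a n * ((a n)⁻¹ * x + -b n / a n) + b n = x := by field_simp; ring
      exact hw ⟨_, hmem, (cos_eq_affine_iff hn hs _ w).1 (by rw [hx']; exact hx)⟩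
    rw [pull_affine, push_cos, tsum_congr h0, tsum_zero, zero_mul]
  · intro z
    have hz := hasDerivAt_mul_const (x := (0 : ℂ)) z
    have h1 := hz.csin.tendsto_slope_zero.comp ha'
    have h2 := hz.ccos.tendsto_slope_zero.comp ha'
    simp only [zero_add, zero_mul, Complex.sin_zero, Complex.cos_zero, sub_zero, one_mul, neg_zero,
      smul_eq_mul, Function.comp_def] at h1 h2
    have h3 := h1.sub (tendsto_mul_zero_of_bounded hK' h2)
    rw [sub_zero] at h3
    refine (tendsto_congr' ?_).2 h3
    filter_upwards [ha0, hsin] with n hn hs using rescaledCos_eq hn hs z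
  · intro z
    have h1 := (Complex.continuous_cos.tendsto 0).comp (haz z)
    have h2 := (Complex.continuous_sin.tendsto 0).comp (haz z)
    rw [Complex.sin_zero] at h2
    have h3 := h1.add (tendsto_mul_zero_of_bounded hK' h2)
    rw [Complex.cos_zero, add_zero] at h3
    refine (tendsto_congr' ?_).2 h3
    filter_upwards [hsin] with n hs using deriv_rescaledCos_eq hs z
  · filter_upwards [hsin, hK', hsmall] with n hs hK hsm z hz
    have hmem : a n * z ∈ Metric.closedBall (0 : ℂ) 1 := by
      rw [mem_closedBall_zero_iff]; exact (hsm z hz).le.trans hδ1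
    rw [deriv_rescaledCos_eq hs]
    refine (norm_add_le _ _).trans (add_le_add (hC₁ _ hmem) ?_)
    rw [norm_mul]
    have hK0 : 0 ≤ K := (norm_nonneg _).trans hK
    gcongr
    exact hC₂ _ hmem

/-! ### Mean value inequality and poles of integrable limits -/

theorem two_pi_mul_enorm_le_lintegral_circle {F : ℂ → ℂ} {c : ℂ} {r ρ : ℝ}
    (hF : DifferentiableOn ℂ F (Metric.ball c r)) (hρ : 0 < ρ) (hρr : ρ < r) :
    ENNReal.ofReal (2 * Real.pi) * ‖F c‖ₑ ≤
      ∫⁻ θ in Set.Ioo (-Real.pi) Real.pi, ‖F (circleMap c ρ θ)‖ₑ := by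
  have hpi := Real.pi_pos
  have hsub : Metric.closedBall c |ρ| ⊆ Metric.ball c r := by
    rw [abs_of_pos hρ]; exact Metric.closedBall_subset_ball hρr
  have hd : DiffContOnCl ℂ F (Metric.ball c |ρ|) := (hF.mono hsub).diffContOnCl_ball le_rfl
  have h1 := hd.circleAverage
  rw [Real.circleAverage_def] at h1
  have hper : Function.Periodic (fun θ => F (circleMap c ρ θ)) (2 * Real.pi) := fun θ => by
    simp only [periodic_circleMap c ρ θ]
  have h2 := hper.intervalIntegral_add_eq (-Real.pi) 0
  rw [zero_add, show -Real.pi + 2 * Real.pi = Real.pi by ring] at h2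
  have h3 : (2 * Real.pi : ℝ) • F c = ∫ θ in Set.Ioo (-Real.pi) Real.pi, F (circleMap c ρ θ) := by
    -- The circle average runs over `(0, 2π)`, polar coordinates over `(-π, π)`; periodicity
    -- reconciles them.
    rw [← integral_Ioc_eq_integral_Ioo, ← intervalIntegral.integral_of_le (by linarith), h2, ← h1,
      smul_inv_smul₀ (by positivity)]
  calc ENNReal.ofReal (2 * Real.pi) * ‖F c‖ₑ = ‖(2 * Real.pi : ℝ) • F c‖ₑ := by
        rw [enorm_smul, Real.enorm_of_nonneg (by positivity)]
    _ ≤ _ := by rw [h3]; exact enorm_integral_le_lintegral_enorm _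

/-- The area form of the mean value inequality for holomorphic functions. -/
theorem mul_enorm_le_lintegral_ball {F : ℂ → ℂ} {c : ℂ} {r : ℝ} (hr : 0 < r)
    (hF : DifferentiableOn ℂ F (Metric.ball c r)) :
    ENNReal.ofReal (Real.pi * r ^ 2) * ‖F c‖ₑ ≤ ∫⁻ z in Metric.ball c r, ‖F z‖ₑ := by
  have hBm : MeasurableSet (Metric.ball c r) := Metric.isOpen_ball.measurableSet
  set g : ℂ → ℝ≥0∞ := (Metric.ball c r).indicator (fun z => ‖F z‖ₑ) with hg
  have hgm : Measurable g := by
    classical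
    rw [hg, ← Set.piecewise_eq_indicator]
    exact hF.continuousOn.enorm.measurable_piecewise continuousOn_const hBm
  have hpolar : ∀ p : ℝ × ℝ, c + Complex.polarCoord.symm p = circleMap c p.1 p.2 := fun p => by
    rw [Complex.polarCoord_symm_apply, circleMap, Complex.exp_mul_I]
    simp
  have hmeas : Measurable fun p : ℝ × ℝ => ENNReal.ofReal p.1 • g (circleMap c p.1 p.2) := by
    refine (measurable_fst.ennreal_ofReal).smul (hgm.comp ?_)
    unfold circleMap
    fun_prop
  rw [← lintegral_indicator hBm, ← lintegral_add_left_eq_self _ c,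
    ← Complex.lintegral_comp_polarCoord_symm]
  simp_rw [hpolar]
  rw [polarCoord_target, Measure.volume_eq_prod, ← Measure.prod_restrict,
    lintegral_prod _ hmeas.aemeasurable]
  have hsub : Set.Ioo 0 r ⊆ Set.Ioi (0 : ℝ) := fun x hx => hx.1
  refine le_trans ?_ (lintegral_mono_set hsub)
  have hrad : ∫⁻ ρ in Set.Ioo 0 r, ENNReal.ofReal ρ = ENNReal.ofReal (r ^ 2 / 2) := by
    rw [← ofReal_integral_eq_lintegral_ofReal, ← integral_Ioc_eq_integral_Ioo,
      ← intervalIntegral.integral_of_le hr.le, integral_id]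
    · simp
    · exact (continuous_id.integrableOn_Icc (a := 0) (b := r)).mono_set Set.Ioo_subset_Icc_self
    · filter_upwards [ae_restrict_mem measurableSet_Ioo] with x hx using hx.1.le
  have hconst : ENNReal.ofReal (Real.pi * r ^ 2) * ‖F c‖ₑ =
      ∫⁻ ρ in Set.Ioo 0 r, ENNReal.ofReal ρ * (ENNReal.ofReal (2 * Real.pi) * ‖F c‖ₑ) := by
    rw [lintegral_mul_const _ (by fun_prop), hrad, ← mul_assoc,
      ← ENNReal.ofReal_mul (by positivity)]
    congr 2; ring
  rw [hconst]
  refine setLIntegral_mono' measurableSet_Ioo fun ρ hρ => ?_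
  have hgc : ∀ θ, g (circleMap c ρ θ) = ‖F (circleMap c ρ θ)‖ₑ := fun θ => by
    rw [hg, Set.indicator_of_mem]
    rw [mem_ball_iff_norm, circleMap_sub_center, norm_circleMap_zero, abs_of_pos hρ.1]
    exact hρ.2
  simp_rw [hgc, smul_eq_mul]
  rw [lintegral_const_mul' _ _ ENNReal.ofReal_ne_top]
  gcongr
  exact two_pi_mul_enorm_le_lintegral_circle hF hρ.1 hρ.2

/-- Without poles only wrong values at removable singularities remain; the normal form corrects them
on a countable set. -/
theorem exists_analytic_ae_eq {F : ℂ → ℂ} {U : Set ℂ} (hF : MeromorphicOn F U)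
    (hpole : ∀ z ∈ U, ¬ IsPole F z) :
    ∃ G : ℂ → ℂ, (∀ z ∈ U, AnalyticAt ℂ G z) ∧ G =ᵐ[volume] F := by
  refine ⟨toMeromorphicNFOn F U, fun z hz => ?_, ?_⟩
  · rw [← (meromorphicNFOn_toMeromorphicNFOn F U hz).meromorphicOrderAt_nonneg_iff_analyticAt,
      meromorphicOrderAt_toMeromorphicNFOn hF hz]
    exact not_lt.1 fun h => hpole z hz ⟨hF z hz, h⟩
  · refine measure_mono_null ?_ (hF.countable_compl_analyticAt_inter.measure_zero volume)
    intro z hz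
    by_contra hcon
    refine hz ?_
    by_cases hzU : z ∈ U
    · have ha : AnalyticAt ℂ F z := by
        by_contra h
        exact hcon ⟨h, hzU⟩
      simp [toMeromorphicNFOn, hF, ← (toMeromorphicNFAt_eq_self.2 ha.meromorphicNFAt).symm]
    · exact toMeromorphicNFOn_eq_self_on_compl hF hzU

/-- Otherwise `q₀` is a.e. an entire integrable function, and the mean value inequality on growing
discs makes it vanish. -/
theorem exists_isPole {q₀ : ℂ → ℂ} (hq : Meromorphic q₀) (h0 : 0 < mass q₀) (hfin : mass q₀ < ∞) :
    ∃ p, IsPole q₀ p := by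
  by_contra! hno
  obtain ⟨G, hG, hae⟩ := exists_analytic_ae_eq (U := Set.univ) (hq.meromorphicOn)
    (fun z _ => hno z)
  have hmass : ∫⁻ z, ‖G z‖ₑ = mass q₀ :=
    lintegral_congr_ae (by filter_upwards [hae] with z hz; rw [hz])
  have hG0 : ∀ z, G z = 0 := by
    intro z
    by_contra hne
    have hbound : ∀ n : ℕ, (n : ℝ≥0∞) ≤ mass q₀ / ‖G z‖ₑ := by
      intro n
      have hz : ‖G z‖ₑ ≠ 0 := by simpa using hne
      rw [ENNReal.le_div_iff_mul_le (Or.inl hz) (Or.inl enorm_ne_top)]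
      have h := mul_enorm_le_lintegral_ball (F := G) (c := z) (r := n + 1) (by positivity)
        (fun w _ => (hG w trivial).differentiableAt.differentiableWithinAt)
      refine le_trans ?_ (h.trans ((setLIntegral_le_lintegral _ _).trans hmass.le))
      gcongr
      rw [← ENNReal.ofReal_natCast]
      apply ENNReal.ofReal_le_ofReal
      nlinarith [Real.pi_gt_three, (Nat.cast_nonneg n : (0 : ℝ) ≤ n)]
    have htop : mass q₀ / ‖G z‖ₑ = ∞ := ENNReal.eq_top_of_forall_nnreal_le fun r => by
      obtain ⟨n, hn⟩ := exists_nat_ge r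
      exact le_trans (by exact_mod_cast hn) (hbound n)
    have := ENNReal.div_ne_top hfin.ne (show ‖G z‖ₑ ≠ 0 by simpa using hne)
    exact this htop
  rw [← hmass] at h0
  simp [hG0] at h0

/-- Poles of an `L¹` limit are limits of poles. -/
theorem eventually_exists_isPole_mem_ball {f : ℕ → ℂ → ℂ} {q₀ : ℂ → ℂ} {p : ℂ} {r : ℝ}
    (hr : 0 < r) (hf : ∀ n, Meromorphic (f n)) (hq : Meromorphic q₀) (hfin : mass q₀ < ∞)
    (hp : IsPole q₀ p) (hlim : Tendsto (fun n => mass (fun z => f n z - q₀ z)) atTop (𝓝 0)) :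
    ∀ᶠ n in atTop, ∃ w ∈ Metric.ball p r, IsPole (f n) w := by
  -- The mean value bound on discs of radius `r / 2` for a pole-free `f n` of mass at most `mass q₀
  -- + 1`. Near `p`, `|q₀| ≥ K + 1`, so the two would differ by at least 1 on a fixed disc.
  set K : ℝ≥0∞ := (mass q₀ + 1) / ENNReal.ofReal (Real.pi * (r / 2) ^ 2) with hK
  have hA : ENNReal.ofReal (Real.pi * (r / 2) ^ 2) ≠ 0 := by
    have := Real.pi_pos
    simp only [ne_eq, ENNReal.ofReal_eq_zero, not_le]; positivity
  have hKfin : K ≠ ∞ := ENNReal.div_ne_top (by finiteness) hA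
  have hblow : ∀ᶠ z in 𝓝[≠] p, K.toReal + 1 ≤ ‖q₀ z‖ := by
    have h := tendsto_norm_cobounded_atTop.comp
      ((tendsto_cobounded_iff_meromorphicOrderAt_neg hp.1).2 hp.2)
    exact h.eventually_ge_atTop _
  rw [eventually_nhdsWithin_iff, Metric.eventually_nhds_iff_ball] at hblow
  obtain ⟨s, hs, hblow⟩ := hblow
  set t := min s (r / 2) with ht
  have ht0 : 0 < t := by positivity
  have hvol : 0 < volume (Metric.ball p t) := Metric.measure_ball_pos _ _ ht0
  have hev := (hlim.eventually_lt_const (lt_min one_pos hvol))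
  filter_upwards [hev] with n hn
  by_contra! hno
  obtain ⟨G, hG, hae⟩ := exists_analytic_ae_eq (U := Metric.ball p r) (hf n).meromorphicOn hno
  have hmassf : mass (f n) ≤ mass q₀ + 1 := by
    have := mass_add_le (fun z => f n z - q₀ z) q₀
      ((hf n).measurable.sub hq.measurable).aemeasurable
    simp only [sub_add_cancel] at this
    rw [add_comm]
    exact this.trans (by gcongr; exact hn.le.trans (min_le_left _ _))
  have hGbound : ∀ z ∈ Metric.ball p t, ‖G z‖ₑ ≤ K := by
    intro z hz
    have hsub : Metric.ball z (r / 2) ⊆ Metric.ball p r := by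
      apply Metric.ball_subset_ball'
      have := (Metric.mem_ball.1 hz).le.trans (min_le_right s (r / 2))
      linarith
    have h := mul_enorm_le_lintegral_ball (F := G) (c := z) (r := r / 2) (by positivity)
      (fun w hw => (hG w (hsub hw)).differentiableAt.differentiableWithinAt)
    rw [hK, ENNReal.le_div_iff_mul_le (Or.inl hA) (Or.inl ENNReal.ofReal_ne_top), mul_comm]
    refine h.trans ((setLIntegral_le_lintegral _ _).trans (le_trans (le_of_eq ?_) hmassf))
    exact lintegral_congr_ae (by filter_upwards [hae] with z hz; rw [hz])
  have hge : volume (Metric.ball p t) ≤ mass (fun z => f n z - q₀ z) := by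
    refine le_trans ?_ (setLIntegral_le_lintegral (Metric.ball p t) _)
    rw [← setLIntegral_one]
    refine lintegral_mono_ae ?_
    have hpne : ∀ᵐ z ∂(volume : Measure ℂ), z ≠ p := Measure.ae_ne volume p
    filter_upwards [ae_restrict_of_ae hae, ae_restrict_mem Metric.isOpen_ball.measurableSet,
      ae_restrict_of_ae hpne] with z hz hzB hzp
    have h1 := hblow z (Metric.ball_subset_ball (min_le_left _ _) hzB) hzp
    have h2 := hGbound z hzB
    rw [hz] at h2
    have h3 : ‖f n z‖ ≤ K.toReal := by
      have := ENNReal.toReal_mono hKfin h2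
      simpa using this
    have h4 := norm_sub_norm_le (q₀ z) (f n z)
    rw [norm_sub_rev] at h4
    rw [← ofReal_norm, ENNReal.one_le_ofReal]
    linarith
  exact absurd (hn.trans_le (min_le_right _ _)) (not_lt.2 hge)

theorem meromorphic_pull_affine {q : ℂ → ℂ} (hq : Meromorphic q) (a b : ℂ) :
    Meromorphic (pull (affine a b) q) := by
  intro z
  have h : MeromorphicAt (q ∘ fun z => a * z + b) z :=
    MeromorphicAt.comp_analyticAt (g := fun z => a * z + b) (hq _) (by fun_prop)
  have h2 := h.mul (MeromorphicAt.const (a ^ 2) z)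
  refine h2.congr (Eventually.of_forall fun w => ?_)
  simp [pull_affine]

theorem IsPole.of_pull_affine {q : ℂ → ℂ} (hq : Meromorphic q) {a b : ℂ} (ha : a ≠ 0) {w : ℂ}
    (hw : IsPole (pull (affine a b) q) w) : IsPole q (a * w + b) := by
  refine ⟨hq _, ?_⟩
  have h : MeromorphicAt (q ∘ fun z => a * z + b) w :=
    MeromorphicAt.comp_analyticAt (g := fun z => a * z + b) (hq _) (by fun_prop)
  have hd : deriv (fun z => a * z + b) w ≠ 0 := by
    simpa using ha
  have h1 : meromorphicOrderAt (q ∘ fun z => a * z + b) w = meromorphicOrderAt q (a * w + b) :=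
    meromorphicOrderAt_comp_of_deriv_ne_zero (by fun_prop) hd
  have h2 := meromorphicOrderAt_mul h (MeromorphicAt.const (a ^ 2) w)
  have h3 : pull (affine a b) q = (q ∘ fun z => a * z + b) * fun _ => a ^ 2 := by
    funext z; simp [pull_affine]
  have h4 := hw.2
  rw [h3, h2, meromorphicOrderAt_const] at h4
  simpa [ha, h1] using h4

theorem HasThickLimitModel.eventually_ne_zero {q : ℕ → ℂ → ℂ} {q₀ : ℂ → ℂ} {a b : ℕ → ℂ}
    (h : HasThickLimitModel q q₀ a b) : ∀ᶠ n in atTop, a n ≠ 0 := by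
  filter_upwards [h.tendsto.eventually_lt_const h.model_mass_pos] with n hn h0
  rw [h0] at hn
  simp [pull_affine, mass] at hn

/-- Near a pole `p` of `q₀` there is `w` with `a_n w + b_n` far from critical points: `p` itself, or
a pole of the pulled-back `q_n`. As `w` stays bounded, `a_n w → 0` and `b_n` inherits the bound. -/
theorem HasThickLimitModel.exists_farFromCritical {q : ℕ → ℂ → ℂ} {q₀ : ℂ → ℂ} {a b : ℕ → ℂ}
    (h : HasThickLimitModel q q₀ a b) (ha : Tendsto a atTop (𝓝 0))
    (hcrit : ModelPolesAvoidCritical q₀ a b ∨ PolesAvoidCritical q) :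
    ∃ δ : ℝ, 0 < δ ∧ ∀ᶠ n in atTop, FarFromCritical δ (b n) := by
  obtain ⟨p, hp⟩ := exists_isPole h.model_meromorphic h.model_mass_pos h.model_mass_lt_top
  suffices ∃ δ : ℝ, 0 < δ ∧ ∀ᶠ n in atTop, ∃ w ∈ Metric.ball p 1,
      FarFromCritical δ (a n * w + b n) by
    obtain ⟨δ, hδ, hev⟩ := this
    refine ⟨δ / 2, by positivity, ?_⟩
    have hlt : ∀ᶠ n in atTop, ‖a n‖ * (‖p‖ + 1) < δ / 2 := by
      have := ha.norm.mul_const (‖p‖ + 1)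
      rw [norm_zero, zero_mul] at this
      exact this.eventually_lt_const (by positivity)
    filter_upwards [hev, hlt] with n ⟨w, hw, hfar⟩ hn
    refine (hfar.sub_dist (b := b n)).mono ?_
    rw [add_sub_cancel_right, norm_mul]
    have h1 : ‖w‖ ≤ ‖p‖ + 1 := by
      have h2 := mem_ball_iff_norm.1 hw
      have h3 := norm_sub_norm_le w p
      linarith
    have h2 : ‖a n‖ * ‖w‖ ≤ ‖a n‖ * (‖p‖ + 1) := by gcongr
    linarith
  rcases hcrit with hcrit | ⟨hmer, δ, hδ, hcrit⟩
  · obtain ⟨δ, hδ, hev⟩ := hcrit p hp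
    exact ⟨δ, hδ, hev.mono fun n hn => ⟨p, Metric.mem_ball_self one_pos, hn⟩⟩
  · refine ⟨δ, hδ, ?_⟩
    have hpoles := eventually_exists_isPole_mem_ball one_pos
      (f := fun n => pull (affine (a n) (b n)) (q n))
      (fun n => meromorphic_pull_affine (hmer n) _ _)
      h.model_meromorphic h.model_mass_lt_top hp h.tendsto
    filter_upwards [hpoles, hcrit, h.eventually_ne_zero] with n ⟨w, hw, hpole⟩ hn hne
    exact ⟨w, hw, hn _ (hpole.of_pull_affine (hmer n) hne)⟩

/-! ### Translation by periods and the limit of the scaling factors -/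

theorem hasSum_cosSymm_add_two_pi {q : ℂ → ℂ} (k : ℤ) {z c : ℂ}
    (h : HasSum (fun i => q (cosSymm i z)) c) :
    HasSum (fun i => q (cosSymm i z + 2 * k * (Real.pi : ℂ))) c := by
  have h2 := ((Equiv.prodCongr (Equiv.addRight k) (Equiv.refl Bool)).hasSum_iff
    (f := fun i => q (cosSymm i z))).2 h
  convert h2 using 1
  funext i
  simp only [Function.comp, Equiv.prodCongr_apply, Prod.map, Equiv.coe_addRight, Equiv.refl_apply,
    cosSymm]
  congr 1
  push_cast
  ring

/-- A translate by a period has the same fibre sums, so the sum of `q` and its translate has twice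
the push-forward of `q`. -/
theorem two_mul_mass_push_cos_le {q : ℂ → ℂ} (hq : AEMeasurable q) (hm : mass q ≠ ∞) (k : ℤ) :
    2 * mass (push Complex.cos q) ≤ mass (fun z => q z + q (z + 2 * k * (Real.pi : ℂ))) := by
  have hq' := aemeasurable_comp_add (2 * k * (Real.pi : ℂ)) hq
  rw [mass, mass, lintegral_eq_lintegral_strip_cos, ← lintegral_const_mul' _ _ ENNReal.ofNat_ne_top,
    lintegral_eq_lintegral_strip_tsum (g := fun z => ‖q z + q (z + 2 * k * (Real.pi : ℂ))‖ₑ)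
      (hq.add hq').enorm]
  refine lintegral_mono_ae ?_
  filter_upwards [ae_summable_cosSymm hq hm, ae_restrict_mem measurableSet_strip] with z h1 hz
  rw [enorm_sin_sq_mul_push_cos q hz]
  have h2 := h1.hasSum.add (hasSum_cosSymm_add_two_pi k h1.hasSum)
  have h3 : ‖∑' i, (q (cosSymm i z) + q (cosSymm i z + 2 * k * (Real.pi : ℂ)))‖ₑ =
      2 * ‖∑' i, q (cosSymm i z)‖ₑ := by
    rw [h2.tsum_eq, ← two_mul, enorm_mul]
    congr 1
    rw [← ofReal_norm]; simp
  rw [← h3]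
  exact enorm_tsum_le_tsum_enorm

theorem mass_comp_add (q : ℂ → ℂ) (T : ℂ) : mass (fun z => q (z + T)) = mass q :=
  lintegral_add_right_eq_self (fun z => ‖q z‖ₑ) T

/-- Translation is continuous in mass. -/
theorem tendsto_mass_translate {q : ℂ → ℂ} (hq : AEMeasurable q) (hm : mass q ≠ ∞) {S : ℕ → ℂ}
    {T : ℂ} (hS : Tendsto S atTop (𝓝 T)) :
    Tendsto (fun n => mass (fun z => q (z + S n) - q (z + T))) atTop (𝓝 0) := by
  have hint : Integrable q := ⟨hq.aestronglyMeasurable, hm.lt_top⟩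
  rw [ENNReal.tendsto_nhds_zero]
  intro ε hε
  have hε3 : ε / 3 ≠ 0 := by simp [hε.ne']
  obtain ⟨φ, hφc, hφq, hφ, -⟩ := hint.exists_hasCompactSupport_lintegral_sub_le hε3
  obtain ⟨M, hM⟩ := hφc.exists_bound_of_continuous hφ
  obtain ⟨R, hR0, hR⟩ := hφc.isCompact.isBounded.subset_ball_lt 0 0
  have hφ0 : ∀ z ∉ Metric.ball (0 : ℂ) R, φ z = 0 := fun z hz =>
    image_eq_zero_of_notMem_tsupport fun h => hz (hR h)
  have hmid : Tendsto (fun n => mass (fun z => φ (z + S n) - φ (z + T))) atTop (𝓝 0) := by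
    have h := tendsto_lintegral_filter_of_dominated_convergence (μ := volume)
      (F := fun n z => ‖φ (z + S n) - φ (z + T)‖ₑ) (l := atTop) (f := fun _ => 0)
      ((Metric.ball (0 : ℂ) (R + ‖T‖ + 1)).indicator fun _ => ENNReal.ofReal (M + M))
      (Eventually.of_forall fun n => by fun_prop) ?_ ?_ ?_
    · simpa [mass] using h
    · have hS1 : ∀ᶠ n in atTop, ‖S n‖ < ‖T‖ + 1 := hS.norm.eventually_lt_const (by linarith)
      filter_upwards [hS1] with n hn
      refine ae_of_all _ fun z => ?_
      by_cases hz : z ∈ Metric.ball (0 : ℂ) (R + ‖T‖ + 1)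
      · rw [Set.indicator_of_mem hz, ← ofReal_norm]
        exact ENNReal.ofReal_le_ofReal ((norm_sub_le _ _).trans (add_le_add (hM _) (hM _)))
      · rw [mem_ball_zero_iff, not_lt] at hz
        have far : ∀ U : ℂ, ‖U‖ ≤ ‖T‖ + 1 → φ (z + U) = 0 := fun U hU => hφ0 _ (by
          rw [mem_ball_zero_iff, not_lt]
          have := norm_sub_le (z + U) U
          rw [add_sub_cancel_right] at this
          linarith)
        rw [far _ hn.le, far T (by linarith)]
        simp
    · rw [lintegral_indicator Metric.isOpen_ball.measurableSet, setLIntegral_const]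
      exact ENNReal.mul_ne_top ENNReal.ofReal_ne_top measure_ball_lt_top.ne
    · refine ae_of_all _ fun z => ?_
      have h1 : Tendsto (fun n => φ (z + S n)) atTop (𝓝 (φ (z + T))) :=
        (hφ.tendsto _).comp (hS.const_add z)
      have := (h1.sub (tendsto_const_nhds (x := φ (z + T)))).enorm
      simpa using this
  filter_upwards [ENNReal.tendsto_nhds_zero.1 hmid (ε / 3) (pos_iff_ne_zero.2 hε3)] with n hn
  have hφm := hφ.measurable.aemeasurable (μ := volume)
  have h1 := mass_sub_le (fun z => q (z + S n)) (fun z => φ (z + S n)) (fun z => q (z + T))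
    (aemeasurable_comp_add _ hq) (aemeasurable_comp_add _ hφm)
  have h2 := mass_sub_le (fun z => φ (z + S n)) (fun z => φ (z + T)) (fun z => q (z + T))
    (aemeasurable_comp_add _ hφm) (aemeasurable_comp_add _ hφm)
  have e1 : mass (fun z => q (z + S n) - φ (z + S n)) ≤ ε / 3 :=
    (mass_comp_add (fun z => q z - φ z) (S n)).trans_le hφq
  have e2 : mass (fun z => φ (z + T) - q (z + T)) ≤ ε / 3 := by
    refine (mass_comp_add (fun z => φ z - q z) T).trans_le (le_trans (le_of_eq ?_) hφq)
    exact lintegral_congr fun z => by rw [← enorm_neg, neg_sub]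
  calc _ ≤ ε / 3 + (ε / 3 + ε / 3) := h1.trans (add_le_add e1 (h2.trans (add_le_add hn e2)))
    _ = ε := by rw [← add_assoc, ENNReal.add_thirds]

/-- Identity theorem; values at the countably many non-analytic points are arbitrary, hence only
a.e. -/
theorem ae_eq_zero_of_meromorphicOrderAt_eq_top {f : ℂ → ℂ} (hf : Meromorphic f) {z₀ : ℂ}
    (h : meromorphicOrderAt f z₀ = ⊤) : ∀ᵐ z, f z = 0 := by
  have htop : ∀ z, meromorphicOrderAt f z = ⊤ := by
    intro z
    by_contra hne
    have := (hf.exists_meromorphicOrderAt_ne_top_iff_forall).1 ⟨z, hne⟩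
    exact this z₀ h
  have hae := (hf.countable_compl_analyticAt).ae_notMem volume
  filter_upwards [hae] with z hz
  have ha : AnalyticAt ℂ f z := by simpa using hz
  have h0 := meromorphicOrderAt_eq_top_iff.1 (htop z)
  exact (ha.continuousAt.eventuallyEq_nhds_iff_eventuallyEq_nhdsNE continuousAt_const).1 h0
    |>.eq_of_nhds

theorem mass_eq_zero_of_ae {f : ℂ → ℂ} (h : ∀ᵐ z, f z = 0) : mass f = 0 := by
  rw [mass, lintegral_congr_ae (g := fun _ => 0) (by filter_upwards [h] with z hz; simp [hz])]
  simp

theorem im_div_eq_zero_of_norm_add_eq {u v : ℂ} (h : ‖u + v‖ = ‖u‖ + ‖v‖) : (v / u).im = 0 := by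
  rcases sameRay_iff_norm_add.2 h with rfl | rfl | ⟨r, s, hr, hs, hrs⟩
  · simp
  · simp
  · by_cases hu : u = 0
    · simp [hu]
    have : v / u = ((r / s : ℝ) : ℂ) := by
      have hs' : (s : ℂ) ≠ 0 := by exact_mod_cast hs.ne'
      rw [Complex.real_smul, Complex.real_smul] at hrs
      push_cast
      field_simp
      linear_combination -hrs
    rw [this, Complex.ofReal_im]

/-- A holomorphic germ with almost everywhere real values is constant. -/
theorem eventually_eq_const_of_ae_im_eq_zero {g : ℂ → ℂ} {z₀ : ℂ} (hg : AnalyticAt ℂ g z₀)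
    (h : ∀ᵐ z, (g z).im = 0) : ∀ᶠ z in 𝓝 z₀, g z = g z₀ := by
  -- Open mapping: a non-constant germ would cover a disc, but by continuity its values near `z₀`
  -- are all real.
  refine hg.eventually_constant_or_nhds_le_map_nhds.resolve_right fun hle => ?_
  obtain ⟨U, hU, hUo, hz₀⟩ := _root_.eventually_nhds_iff.1 hg.eventually_analyticAt
  have him : Set.EqOn (fun z => (g z).im) (fun _ => 0) U :=
    Measure.eqOn_open_of_ae_eq (ae_restrict_of_ae h) hUo
      (fun z hz => (Complex.continuous_im.continuousAt.comp (hU z hz).continuousAt).continuousWithinAt)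
      continuousOn_const
  have hmem : {w : ℂ | w.im = 0} ∈ 𝓝 (g z₀) := hle (mem_map.2 (mem_of_superset
    (hUo.mem_nhds hz₀) him))
  obtain ⟨ε, hε, hball⟩ := Metric.mem_nhds_iff.1 hmem
  have h1 : (g z₀).im = 0 := him hz₀
  have h2 : g z₀ + (ε / 2 : ℝ) * Complex.I ∈ Metric.ball (g z₀) ε := by
    rw [mem_ball_iff_norm, add_sub_cancel_left, norm_mul, Complex.norm_I, Complex.norm_real,
      Real.norm_of_nonneg (by positivity)]
    linarith
  have h3 : (g z₀ + (ε / 2 : ℝ) * Complex.I).im = 0 := hball h2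
  rw [Complex.add_im, h1, Complex.im_ofReal_mul, Complex.I_im] at h3
  linarith

/-- An integrable function cannot have a periodic modulus. -/
theorem mass_eq_zero_of_enorm_periodic {q : ℂ → ℂ} (hq : AEMeasurable q) (hm : mass q ≠ ∞) {T : ℂ}
    (hT : T ≠ 0) (h : ∀ᵐ z, ‖q (z + T)‖ₑ = ‖q z‖ₑ) : mass q = 0 := by
  have hiter : ∀ n : ℕ, ∀ᵐ z, ‖q (z + n * T)‖ₑ = ‖q z‖ₑ := by
    intro n
    induction n with
    | zero => simp
    | succ n ih =>
      have h' := (measurePreserving_add_right volume (n * T)).quasiMeasurePreserving.ae h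
      filter_upwards [ih, h'] with z h1 h2
      rw [← h1, ← h2]
      push_cast
      ring_nf
  -- A positive weight vanishing at infinity. Moving it by `nT` leaves the weighted mass unchanged
  -- by periodicity, yet sends it to 0 by dominated convergence.
  set w : ℂ → ℝ≥0∞ := fun z => ENNReal.ofReal (1 + ‖z‖)⁻¹ with hw
  have hwm : Measurable w := by
    rw [hw]
    exact ((measurable_norm.const_add 1).inv).ennreal_ofReal
  have hconst : ∀ n : ℕ, ∫⁻ z, w (z - n * T) * ‖q z‖ₑ = ∫⁻ z, w z * ‖q z‖ₑ := by
    intro n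
    rw [← lintegral_add_right_eq_self (fun z => w (z - n * T) * ‖q z‖ₑ) (n * T)]
    refine lintegral_congr_ae ?_
    filter_upwards [hiter n] with z hz
    rw [hz, add_sub_cancel_right]
  have hlim : Tendsto (fun n : ℕ => ∫⁻ z, w (z - n * T) * ‖q z‖ₑ) atTop (𝓝 0) := by
    have hd := tendsto_lintegral_filter_of_dominated_convergence' (μ := volume)
      (F := fun (n : ℕ) z => w (z - n * T) * ‖q z‖ₑ) (l := atTop) (f := fun _ => 0)
      (fun z => ‖q z‖ₑ)
      (Eventually.of_forall fun n =>
        (hwm.comp (measurable_id.sub_const _)).aemeasurable.mul hq.enorm) ?_ hm ?_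
    · simpa using hd
    · refine Eventually.of_forall fun n => ae_of_all _ fun z => ?_
      have h1 : w (z - n * T) ≤ 1 := by
        rw [hw]
        refine ENNReal.ofReal_le_one.2 (inv_le_one_of_one_le₀ ?_)
        linarith [norm_nonneg (z - n * T)]
      simpa using mul_le_mul_left h1 ‖q z‖ₑ
    · have hfin : ∀ᵐ z, ‖q z‖ₑ < ∞ := ae_of_all _ fun z => enorm_lt_top
      filter_upwards [hfin] with z hz
      have hnorm : Tendsto (fun n : ℕ => 1 + ‖z - n * T‖) atTop atTop := by
        refine tendsto_atTop_mono (f := fun n : ℕ => (n : ℝ) * ‖T‖ + (-‖z‖)) (fun n => ?_)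
          (tendsto_atTop_add_const_right _ _
            (tendsto_natCast_atTop_atTop.atTop_mul_const (norm_pos_iff.2 hT)))
        have := norm_sub_norm_le (n * T) z
        rw [norm_sub_rev, norm_mul, Complex.norm_natCast] at this
        linarith
      have h1 : Tendsto (fun n : ℕ => w (z - n * T)) atTop (𝓝 0) := by
        simpa using ENNReal.tendsto_ofReal hnorm.inv_tendsto_atTop
      simpa using ENNReal.Tendsto.mul_const h1 (Or.inr hz.ne)
  simp_rw [hconst] at hlim
  have hzero := tendsto_nhds_unique hlim tendsto_const_nhds
  replace hzero := (lintegral_eq_zero_iff' (f := fun z => w z * ‖q z‖ₑ)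
    (hwm.aemeasurable.mul hq.enorm)).1 hzero.symm
  refine mass_eq_zero_of_ae ?_
  filter_upwards [hzero] with z hz
  have hw0 : w z ≠ 0 := by
    simp only [hw, ne_eq, ENNReal.ofReal_eq_zero, not_le]
    positivity
  simpa [hw0] using hz

/-- Equality would force `q(z + T) = c q(z)` a.e. with `|c| = 1`: an integrable function of periodic
modulus. -/
theorem mass_add_translate_lt {q : ℂ → ℂ} (hq : Meromorphic q) (h0 : 0 < mass q)
    (hfin : mass q < ∞) {T : ℂ} (hT : T ≠ 0) :
    mass (fun z => q z + q (z + T)) < 2 * mass q := by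
  by_contra! hle
  have hqm : Measurable q := hq.measurable
  have hqT : Meromorphic fun z => q (z + T) := fun z =>
    MeromorphicAt.comp_analyticAt (g := fun z => z + T) (hq _) (by fun_prop)
  have hsum : ∫⁻ z, (‖q z‖ₑ + ‖q (z + T)‖ₑ) = 2 * mass q := by
    rw [lintegral_add_left hqm.enorm, two_mul]
    congr 1
    exact mass_comp_add q T
  have hnorm : ∀ᵐ z, ‖q z + q (z + T)‖ₑ = ‖q z‖ₑ + ‖q (z + T)‖ₑ :=
    ae_eq_of_ae_le_of_lintegral_le (ae_of_all _ fun z => enorm_add_le _ _)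
      (ne_top_of_le_ne_top (by finiteness)
        ((lintegral_mono fun z => enorm_add_le (q z) (q (z + T))).trans hsum.le))
      (hqm.enorm.add hqT.measurable.enorm).aemeasurable (by rw [hsum]; exact hle)
  set g : ℂ → ℂ := fun z => q (z + T) / q z with hg
  have hgm : Meromorphic g := hqT.div hq
  have him : ∀ᵐ z, (g z).im = 0 := by
    filter_upwards [hnorm] with z hz
    apply im_div_eq_zero_of_norm_add_eq
    have := congrArg ENNReal.toReal hz
    rwa [ENNReal.toReal_add enorm_ne_top enorm_ne_top, toReal_enorm, toReal_enorm,
      toReal_enorm] at this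
  obtain ⟨z₀, hz₀⟩ : ∃ z₀, AnalyticAt ℂ g z₀ := by
    obtain ⟨z, hz⟩ := (hgm.countable_compl_analyticAt.ae_notMem volume).exists
    exact ⟨z, by simpa using hz⟩
  set c := g z₀ with hc
  have hconst := eventually_eq_const_of_ae_im_eq_zero hz₀ him
  have hord : meromorphicOrderAt q z₀ ≠ ⊤ := fun h =>
    h0.ne' (mass_eq_zero_of_ae (ae_eq_zero_of_meromorphicOrderAt_eq_top hq h))
  have hne := (meromorphicOrderAt_ne_top_iff_eventually_ne_zero (hq z₀)).1 hord
  have hdiff : Meromorphic fun z => q (z + T) - c * q z := fun z =>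
    (hqT z).sub ((MeromorphicAt.const c z).mul (hq z))
  have htop : meromorphicOrderAt (fun z => q (z + T) - c * q z) z₀ = ⊤ := by
    rw [meromorphicOrderAt_eq_top_iff]
    filter_upwards [hne, hconst.filter_mono nhdsWithin_le_nhds] with z h1 h2
    rw [hc, ← h2, hg]
    field_simp
    ring
  have hall := ae_eq_zero_of_meromorphicOrderAt_eq_top hdiff htop
  have hall' : ∀ᵐ z, ‖q (z + T)‖ₑ = ‖c‖ₑ * ‖q z‖ₑ := by
    filter_upwards [hall] with z hz
    rw [sub_eq_zero.1 hz, enorm_mul]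
  have hmass : mass q = ‖c‖ₑ * mass q := by
    conv_lhs => rw [← mass_comp_add q T]
    rw [mass, lintegral_congr_ae hall', lintegral_const_mul _ hqm.enorm]
    rfl
  have hc1 : ‖c‖ₑ = 1 := by
    have := (ENNReal.mul_left_inj h0.ne' hfin.ne).1 ((one_mul (mass q)).trans hmass)
    exact this.symm
  refine h0.ne' (mass_eq_zero_of_enorm_periodic hqm.aemeasurable hfin.ne hT ?_)
  filter_upwards [hall'] with z hz
  rw [hz, hc1, one_mul]

theorem tendsto_mass_push_cos {q : ℕ → ℂ → ℂ} (heff : CosEfficient q) {L : ℝ≥0∞}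
    (hfin : ∀ n, mass (q n) < ∞) (hlim : Tendsto (fun n => mass (q n)) atTop (𝓝 L)) :
    Tendsto (fun n => mass (push Complex.cos (q n))) atTop (𝓝 L) := by
  have h := ENNReal.Tendsto.mul heff.2 (Or.inl one_ne_zero) hlim (Or.inr ENNReal.one_ne_top)
  rw [one_mul] at h
  refine h.congr fun n => ?_
  rw [ENNReal.div_mul_cancel (heff.1 n) (hfin n).ne]

theorem HasThickLimitModel.mass_model_le {q : ℕ → ℂ → ℂ} {q₀ : ℂ → ℂ} {a b : ℕ → ℂ}
    (h : HasThickLimitModel q q₀ a b) {L : ℝ≥0∞}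
    (hlim : Tendsto (fun n => mass (q n)) atTop (𝓝 L)) : mass q₀ ≤ L := by
  have h1 := h.tendsto.add hlim
  rw [zero_add] at h1
  refine ge_of_tendsto h1 ?_
  filter_upwards [h.eventually_ne_zero] with n hn
  have hp : AEMeasurable (pull (affine (a n) (b n)) (q n)) :=
    aemeasurable_pull_affine hn _ (h.measurable n)
  have h2 := mass_add_le (fun z => q₀ z - pull (affine (a n) (b n)) (q n) z)
    (pull (affine (a n) (b n)) (q n)) (h.model_meromorphic.measurable.aemeasurable.sub hp)
  simp only [sub_add_cancel] at h2
  rw [mass_pull_affine hn] at h2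
  refine h2.trans (add_le_add (le_of_eq ?_) le_rfl)
  exact lintegral_congr fun z => by rw [← enorm_neg, neg_sub]

theorem HasThickLimitModel.two_mul_mass_le_of_translate {q : ℕ → ℂ → ℂ} {q₀ : ℂ → ℂ} {a b : ℕ → ℂ}
    (h : HasThickLimitModel q q₀ a b) (heff : CosEfficient q) {s : ℕ → ℕ}
    (hs : Tendsto s atTop atTop) {k : ℕ → ℤ} {T : ℂ}
    (hT : Tendsto (fun n => 2 * k n * (Real.pi : ℂ) / a (s n)) atTop (𝓝 T)) :
    2 * mass q₀ ≤ mass (fun z => q₀ z + q₀ (z + T)) := by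
  obtain ⟨L, -, hL, hlim⟩ := h.mass_lim
  have hpush := (tendsto_mass_push_cos heff h.mass_lt_top hlim).comp hs
  have hq₀ : AEMeasurable q₀ := h.model_meromorphic.measurable.aemeasurable
  have htrans := tendsto_mass_translate hq₀ h.model_mass_lt_top.ne hT
  have herr := h.tendsto.comp hs
  have hR := (herr.add herr).add (htrans.add
    (tendsto_const_nhds (x := mass (fun z => q₀ z + q₀ (z + T)))))
  simp only [zero_add] at hR
  have hL2 := ENNReal.Tendsto.const_mul hpush (Or.inr (ENNReal.ofNat_ne_top (n := 2)))
  calc 2 * mass q₀ ≤ 2 * L := by gcongr; exact h.mass_model_le hlim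
    _ ≤ _ := le_of_tendsto_of_tendsto hL2 hR ?_
  filter_upwards [hs.eventually h.eventually_ne_zero] with n hn
  simp only [Function.comp]
  set Q := pull (affine (a (s n)) (b (s n))) (q (s n)) with hQ
  set U : ℂ := 2 * k n * (Real.pi : ℂ) / a (s n) with hU
  have hQm : AEMeasurable Q := aemeasurable_pull_affine hn _ (h.measurable _)
  refine (two_mul_mass_push_cos_le (h.measurable _) (h.mass_lt_top _).ne (k n)).trans ?_
  rw [← mass_pull_affine hn (b (s n))]
  -- In model coordinates the period becomes a shift by `U`. Two model errors, one translation error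
  -- and the limiting sum are separated.
  have e1 : pull (affine (a (s n)) (b (s n)))
      (fun z => q (s n) z + q (s n) (z + 2 * k n * (Real.pi : ℂ))) =
      fun z => ((Q z - q₀ z) + (Q (z + U) - q₀ (z + U))) +
        ((q₀ (z + U) - q₀ (z + T)) + (q₀ z + q₀ (z + T))) := by
    funext z
    have : a (s n) * (z + U) + b (s n) = a (s n) * z + b (s n) + 2 * k n * (Real.pi : ℂ) := by
      rw [hU]; field_simp; ring
    rw [hQ, pull_affine, pull_affine, pull_affine, this]
    ring
  rw [e1]
  have hd : AEMeasurable fun z => Q z - q₀ z := hQm.sub hq₀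
  refine (mass_add_le _ _ (hd.add (aemeasurable_comp_add U hd))).trans (add_le_add ?_ ?_)
  · exact (mass_add_le _ _ hd).trans
      (add_le_add le_rfl (mass_comp_add (fun z => Q z - q₀ z) U).le)
  · exact mass_add_le _ _ ((aemeasurable_comp_add U hq₀).sub (aemeasurable_comp_add T hq₀))

theorem HasThickLimitModel.tendsto_zero {q : ℕ → ℂ → ℂ} {q₀ : ℂ → ℂ} {a b : ℕ → ℂ}
    (h : HasThickLimitModel q q₀ a b) (heff : CosEfficient q) : Tendsto a atTop (𝓝 0) := by
  by_contra hcon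
  obtain ⟨ε, hε, hfreq⟩ : ∃ ε > 0, ∃ᶠ n in atTop, ε ≤ ‖a n‖ := by
    rw [NormedAddGroup.tendsto_nhds_zero] at hcon
    push Not at hcon
    obtain ⟨ε, hε, hf⟩ := hcon
    exact ⟨ε, hε, hf⟩
  obtain ⟨s, hs, hsa⟩ := extraction_of_frequently_atTop hfreq
  have hpi := Real.pi_pos
  -- Rounding up gives `1 ≤ |U n| ≤ 1 + 2π/ε`: compactness supplies a limit, and the lower bound
  -- makes it non-zero.
  set k : ℕ → ℕ := fun n => ⌈‖a (s n)‖ / (2 * Real.pi)⌉₊ with hk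
  set U : ℕ → ℂ := fun n => 2 * (k n : ℤ) * (Real.pi : ℂ) / a (s n) with hU
  have hnorm : ∀ n, ‖U n‖ = 2 * k n * Real.pi / ‖a (s n)‖ := fun n => by
    simp [hU, abs_of_pos hpi]
  have hpos : ∀ n, 0 < ‖a (s n)‖ := fun n => hε.trans_le (hsa n)
  have hlow : ∀ n, 1 ≤ ‖U n‖ := fun n => by
    have h1 := Nat.le_ceil (‖a (s n)‖ / (2 * Real.pi))
    rw [div_le_iff₀ (by positivity)] at h1
    rw [hnorm, one_le_div (hpos n)]
    linarith
  have hup : ∀ n, U n ∈ Metric.closedBall (0 : ℂ) (1 + 2 * Real.pi / ε) := fun n => by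
    have h1 := (Nat.ceil_lt_add_one (a := ‖a (s n)‖ / (2 * Real.pi)) (by positivity)).le
    rw [mem_closedBall_zero_iff, hnorm, div_le_iff₀ (hpos n)]
    have h2 : 2 * Real.pi ≤ 2 * Real.pi / ε * ‖a (s n)‖ := by
      rw [div_mul_eq_mul_div, le_div_iff₀ hε]
      gcongr
      exact hsa n
    have h3 : (k n : ℝ) * (2 * Real.pi) ≤ ‖a (s n)‖ + 2 * Real.pi := by
      calc (k n : ℝ) * (2 * Real.pi) ≤ (‖a (s n)‖ / (2 * Real.pi) + 1) * (2 * Real.pi) := by gcongr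
        _ = _ := by field_simp
    linarith
  obtain ⟨T, -, t, ht, hlim⟩ := (isCompact_closedBall _ _).tendsto_subseq hup
  have hT : T ≠ 0 := by
    have : 1 ≤ ‖T‖ := ge_of_tendsto' hlim.norm fun n => hlow (t n)
    exact norm_pos_iff.1 (by linarith)
  exact absurd
    (h.two_mul_mass_le_of_translate heff (s := s ∘ t) (k := fun n => (k (t n) : ℤ))
      (hs.tendsto_atTop.comp ht.tendsto_atTop) hlim)
    (not_le.2 (mass_add_translate_lt h.model_meromorphic h.model_mass_pos h.model_mass_lt_top hT))

/-! ### Convergence of the rescaled push-forwards -/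

theorem HasThickLimitModel.tendsto_mass_pull_push_sub {q : ℕ → ℂ → ℂ} {q₀ : ℂ → ℂ} {a b : ℕ → ℂ}
    (h : HasThickLimitModel q q₀ a b) (ha : Tendsto a atTop (𝓝 0)) {δ : ℝ} (hδ : 0 < δ)
    (hb : ∀ᶠ n in atTop, FarFromCritical δ (b n)) :
    Tendsto (fun n => mass (fun z =>
      pull (affine (-a n * Complex.sin (b n)) (Complex.cos (b n)))
        (push Complex.cos (q n)) z - q₀ z)) atTop (𝓝 0) := by
  have hq₀ : AEMeasurable q₀ := h.model_meromorphic.measurable.aemeasurable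
  have hint : Integrable q₀ := ⟨hq₀.aestronglyMeasurable, h.model_mass_lt_top⟩
  rw [ENNReal.tendsto_nhds_zero]
  intro ε hε
  have hε4 : 0 < ε / 2 / 2 := by simp [hε.ne']
  obtain ⟨φ, hφc, hφq, hφ, hφi⟩ := hint.exists_hasCompactSupport_lintegral_sub_le hε4.ne'
  have hφm : AEMeasurable φ := hφ.measurable.aemeasurable
  have hφfin : mass φ ≠ ∞ := hφi.2.ne
  have hφq' : mass (fun z => φ z - q₀ z) ≤ ε / 2 / 2 :=
    le_trans (le_of_eq (lintegral_congr fun z => by rw [← enorm_neg, neg_sub])) hφq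
  have hmid := tendsto_mass_pull_push_cos hφ hφc ha h.eventually_ne_zero hδ hb
  filter_upwards [ENNReal.tendsto_nhds_zero.1 hmid _ hε4,
    ENNReal.tendsto_nhds_zero.1 h.tendsto _ hε4, h.eventually_ne_zero, hb] with n h1 h2 hn hbn
  have hs := hbn.sin_ne_zero hδ
  have hM : -a n * Complex.sin (b n) ≠ 0 := mul_ne_zero (neg_ne_zero.2 hn) hs
  -- `φ` carried by the inverse scaling to the coordinates of `q n`, so that both can be pushed
  -- forward and compared there.
  set ψ := pull (affine (a n)⁻¹ (-b n / a n)) φ with hψ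
  have hψm : AEMeasurable ψ := aemeasurable_pull_affine (inv_ne_zero hn) _ hφm
  have hψfin : mass ψ ≠ ∞ := by rw [hψ, mass_pull_affine (inv_ne_zero hn)]; exact hφfin
  have hback : pull (affine (a n) (b n)) ψ = φ := by
    funext z
    rw [hψ, pull_affine, pull_affine]
    have : (a n)⁻¹ * (a n * z + b n) + -b n / a n = z := by field_simp; ring
    rw [this]
    field_simp
  have hpq := aemeasurable_push_cos (h.measurable n) (h.mass_lt_top n).ne
  have hpψ := aemeasurable_push_cos hψm hψfin
  set A := affine (-a n * Complex.sin (b n)) (Complex.cos (b n)) with hA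
  have hfirst : mass (fun z => pull A (push Complex.cos (q n)) z - pull A (push Complex.cos ψ) z) ≤
      ε / 2 / 2 + ε / 2 / 2 := by
    have e1 : (fun z => pull A (push Complex.cos (q n)) z - pull A (push Complex.cos ψ) z) =
        pull A (fun w => push Complex.cos (q n) w - push Complex.cos ψ w) :=
      funext fun z => (pull_affine_sub _ _ _ _ z).symm
    rw [e1, hA, mass_pull_affine hM]
    refine (mass_push_cos_sub_le (h.measurable n) hψm (h.mass_lt_top n).ne hψfin).trans ?_
    rw [← mass_pull_affine hn (b n)]
    have e2 : pull (affine (a n) (b n)) (fun z => q n z - ψ z) =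
        fun z => pull (affine (a n) (b n)) (q n) z - φ z := by
      funext z; rw [pull_affine_sub, hback]
    rw [e2]
    exact (mass_sub_le _ q₀ φ (aemeasurable_pull_affine hn _ (h.measurable n)) hq₀).trans (add_le_add h2 hφq)
  calc mass (fun z => pull A (push Complex.cos (q n)) z - q₀ z)
      ≤ (ε / 2 / 2 + ε / 2 / 2) + (ε / 2 / 2 + ε / 2 / 2) :=
        (mass_sub_le _ (pull A (push Complex.cos ψ)) q₀ (aemeasurable_pull_affine hM _ hpq) (aemeasurable_pull_affine hM _ hpψ)).trans
          (add_le_add hfirst ((mass_sub_le _ φ q₀ (aemeasurable_pull_affine hM _ hpψ) hφm).trans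
            (add_le_add h1 hφq')))
    _ = ε := by
      rw [ENNReal.add_halves, ENNReal.add_halves]

end QuadDiff

theorem proposition5p1 (q : ℕ → ℂ → ℂ) (q₀ : ℂ → ℂ) (a b : ℕ → ℂ)
    (hlim : QuadDiff.HasThickLimitModel q q₀ a b) (heff : QuadDiff.CosEfficient q) :
    Tendsto a atTop (𝓝 0) ∧
    (QuadDiff.ModelPolesAvoidCritical q₀ a b ∨ QuadDiff.PolesAvoidCritical q →
      ∃ N : ℕ, QuadDiff.HasThickLimitModel
        (fun n => QuadDiff.push Complex.cos (q (n + N))) q₀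
        (fun n => -a (n + N) * Complex.sin (b (n + N)))
        (fun n => Complex.cos (b (n + N)))) := by
  have ha := hlim.tendsto_zero heff
  refine ⟨ha, fun hcrit => ?_⟩
  obtain ⟨δ, hδ, hb⟩ := hlim.exists_farFromCritical ha hcrit
  obtain ⟨L, hL0, hL, hmass⟩ := hlim.mass_lim
  have hpush := QuadDiff.tendsto_mass_push_cos heff hlim.mass_lt_top hmass
  -- The push-forward masses tend to `L ≠ 0`, so they are positive from some `N` on.
  obtain ⟨N, hN⟩ := eventually_atTop.1 (hpush.eventually_const_lt (pos_iff_ne_zero.2 hL0))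
  exact ⟨N,
    { measurable := fun n =>
        QuadDiff.aemeasurable_push_cos (hlim.measurable _) (hlim.mass_lt_top _).ne
      mass_pos := fun n => hN _ (Nat.le_add_left _ _)
      mass_lt_top := fun n =>
        (QuadDiff.mass_push_cos_le (hlim.measurable _)).trans_lt (hlim.mass_lt_top _)
      mass_lim := ⟨L, hL0, hL, hpush.comp (tendsto_add_atTop_nat N)⟩
      model_meromorphic := hlim.model_meromorphic
      model_mass_pos := hlim.model_mass_pos
      model_mass_lt_top := hlim.model_mass_lt_top
      tendsto := (hlim.tendsto_mass_pull_push_sub ha hδ hb).comp (tendsto_add_atTop_nat N) }⟩
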